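/- Let $d\ge 0$ and $k\geq 2$ be integers, let $p_k=\frac{2^k}{k+1}$, and let $s_k=\frac{2^k}{2^k-k-1}$ be its Hölder conjugate. All functions are measurable and real-valued on $\mathbb{R}^d$. The Gowers--Host--Kra norms are defined by $\|f\|_{U(1)}=\left|\int f\,dx\right|$ and $\|f\|_{U(j+1)}^{2^{j+1}}=\int_{\mathbb{R}^d}\|f^h\cdot f\|_{U(j)}^{2^j}\,dh$ for $j\geq 1$, where $f^h(x)=f(x+h)$. The dual function of $f$ is $$D_kf(x)=\int_{(\mathbb{R}^d)^k}\ \prod_{\alpha\in\{0,1\}^k\setminus\{0\}}f(x+\alpha_1h_1+\cdots+\alpha_kh_k)\,dh_1\cdots dh_k .$$ For $g\in L^{s_k}(\mathbb{R}^d)$ put $\|g\|_{U(k)}^*=\sup\{|\int gf\,dx| : f\in L^{p_k}(\mathbb{R}^d),\ \|f\|_{U(k)}\leq 1\}\in[0,\infty]$. Theorem. For every $g\in L^{s_k}(\mathbb{R}^d)$ with $\|g\|_{U(k)}^*=1$ and every $\delta>0$ there are functions $F\in L^{p_k}(\mathbb{R}^d)$ and $H\in L^{s_k}(\mathbb{R}^d)$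 such that the integral defining $D_kF(x)$ converges absolutely for almost every $x$, and $$g=D_kF+H\quad\text{almost everywhere},\qquad \|F\|_{U(k)}\leq 1,\qquad \|F\|_{p_k}\leq \frac1\delta,\qquad \|H\|_{s_k}\leq\delta .$$ -/

import Mathlib

open MeasureTheory
open scoped ENNReal

noncomputable section

/-- The exponent `p_k = 2^k / (k + 1)`. -/
def pExp (k : ℕ) : ℝ := 2 ^ k / ((k : ℝ) + 1)

/-- The exponent `s_k = 2^k / (2^k - k - 1)`, for `k ≥ 2` the Hölder conjugate of `p_k`. -/
def sExp (k : ℕ) : ℝ := 2 ^ k / (2 ^ k - (k : ℝ) - 1)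

/-- The Gowers-Host-Kra norm of a real function on `ℝ^d`, valued in `[0, ∞]`:
`‖f‖_{U(1)} = |∫ f|` and `‖f‖_{U(k+1)}^{2^(k+1)} = ∫ ‖f^h f‖_{U(k)}^{2^k} dh`, where
`f^h(x) = f(x + h)`. The value at index `0` is a placeholder that is never used. -/
def gowersNorm {d : ℕ} : ℕ → (EuclideanSpace ℝ (Fin d) → ℝ) → ℝ≥0∞
  | 0, _ => 0
  | 1, f => ‖∫ x, f x‖ₑ
  | k + 2, f =>
      (∫⁻ h : EuclideanSpace ℝ (Fin d),
        gowersNorm (k + 1) (fun x => f (x + h) * f x) ^ (2 ^ (k + 1) : ℕ)) ^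
          (1 / 2 ^ (k + 2) : ℝ)

/-- The product `∏ f(x + α · h)` over the nonzero vertices `α` of the cube `{0,1}^k`, where
`h = (h_1, …, h_k)` and `α · h = α_1 h_1 + ⋯ + α_k h_k`. -/
def cubeProd {d : ℕ} (k : ℕ) (f : EuclideanSpace ℝ (Fin d) → ℝ)
    (x : EuclideanSpace ℝ (Fin d)) (h : Fin k → EuclideanSpace ℝ (Fin d)) : ℝ :=
  ∏ α ∈ Finset.univ.erase (0 : Fin k → Fin 2), f (x + ∑ i, (α i : ℕ) • h i)

/-- The Gowers-Host-Kra dual function `D_k f(x) = ∫ ∏_{α ≠ 0} f(x + α · h) dh`. -/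
def dualFun {d : ℕ} (k : ℕ) (f : EuclideanSpace ℝ (Fin d) → ℝ)
    (x : EuclideanSpace ℝ (Fin d)) : ℝ :=
  ∫ h : Fin k → EuclideanSpace ℝ (Fin d), cubeProd k f x h

/-- The anti-uniform norm, valued in `[0, ∞]`: the supremum of `|⟨g, f⟩|` over all `f` in
`L^{p_k}` with `‖f‖_{U(k)} ≤ 1`. -/
def antiUniformNorm {d : ℕ} (k : ℕ) (g : EuclideanSpace ℝ (Fin d) → ℝ) : ℝ≥0∞ :=
  ⨆ (f : EuclideanSpace ℝ (Fin d) → ℝ)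
    (_ : MemLp f (ENNReal.ofReal (pExp k)) volume ∧ gowersNorm k f ≤ 1),
      ‖∫ x, g x * f x‖ₑ

end

/-!
The Gowers inner product is a bounded multilinear form on `L^{p_k}`, so `f ↦ ‖f‖_{U(k)}^{2^k}` is
continuous there, and the Gowers-Cauchy-Schwarz inequality makes `w ↦ ∫ w D_k f` a
subgradient of `2^{-k} ‖·‖_{U(k)}^{2^k}` at `f`. Hence
`f ↦ 2^{-k} ‖f‖_{U(k)}^{2^k} - ∫ g f + δ^{p_k} p_k^{-1} ‖f‖_{p_k}^{p_k}`
is convex, uniformly so on bounded sets, and has a minimizer `F`. Its Euler-Lagrange equation is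
`g = D_k F + H` with `H = δ^{p_k} |F|^{p_k - 2} F`. Pairing with `F` gives
`‖F‖_{U(k)}^{2^k} + δ^{p_k} ‖F‖_{p_k}^{p_k} = ∫ g F ≤ ‖F‖_{U(k)}`, which forces both terms on the
left to be at most `1`.
-/

noncomputable section

namespace GowersHostKra

section Minimization

open Filter Topology

variable {V : Type*} [NormedAddCommGroup V] [NormedSpace ℝ V] {Φ : V → ℝ}

/-- Uniform midpoint convexity forces every minimizing sequence to be Cauchy. -/
theorem exists_forall_le_of_uniform_midpoint [CompleteSpace V] (hΦ : Continuous Φ)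
    (hbdd : BddBelow (Set.range Φ))
    (hconv : ∀ ε > 0, ∀ R, ∃ η > 0, ∀ x y, Φ x ≤ R → Φ y ≤ R → ε ≤ ‖x - y‖ →
      Φ (midpoint ℝ x y) + η ≤ (Φ x + Φ y) / 2) :
    ∃ x, ∀ y, Φ x ≤ Φ y := by
  set m := sInf (Set.range Φ)
  have hm (x : V) : m ≤ Φ x := csInf_le hbdd ⟨x, rfl⟩
  obtain ⟨v, -, hlim, hrange⟩ := exists_seq_tendsto_sInf (Set.range_nonempty Φ) hbdd
  choose u hu using hrange
  obtain rfl : Φ ∘ u = v := funext hu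
  have hcauchy : CauchySeq u := by
    refine Metric.cauchySeq_iff.2 fun ε hε => ?_
    obtain ⟨η, hη, hgap⟩ := hconv ε hε (m + 1)
    obtain ⟨N, hN⟩ : ∃ N, ∀ n ≥ N, Φ (u n) < m + η ∧ Φ (u n) < m + 1 :=
      eventually_atTop.1 ((hlim.eventually (gt_mem_nhds (lt_add_of_pos_right m hη))).and
        (hlim.eventually (gt_mem_nhds (lt_add_one m))))
    refine ⟨N, fun i hi j hj => ?_⟩
    by_contra! hfar
    have hmid := hgap (u i) (u j) (hN i hi).2.le (hN j hj).2.le (dist_eq_norm (u i) _ ▸ hfar)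
    linarith [hm (midpoint ℝ (u i) (u j)), (hN i hi).1, (hN j hj).1]
  obtain ⟨x, hx⟩ := cauchySeq_tendsto_of_complete hcauchy
  exact ⟨x, fun y => tendsto_nhds_unique ((hΦ.tendsto x).comp hx) hlim ▸ hm y⟩

variable {A : V → V →L[ℝ] ℝ}

theorem two_mul_midpoint_le_of_subgradient (hA : ∀ x y, Φ x + A x (y - x) ≤ Φ y) (x y : V) :
    2 * Φ (midpoint ℝ x y) ≤ Φ x + Φ y := by
  have hsum := (A (midpoint ℝ x y)).map_add (x - midpoint ℝ x y) (y - midpoint ℝ x y)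
  rw [sub_add_sub_comm, midpoint_add_self, sub_self, map_zero] at hsum
  linarith [hA (midpoint ℝ x y) x, hA (midpoint ℝ x y) y]

/-- Minty's device: the subgradient inequality at the points `x + t • w` towards `x` gives
`0 ≤ A (x + t • w) w` for `t > 0`, and then `t → 0`. -/
theorem subgradient_eq_zero_of_forall_le (hA : ∀ x y, Φ x + A x (y - x) ≤ Φ y) {x : V}
    (hmin : ∀ y, Φ x ≤ Φ y)
    (hcont : ∀ w, Tendsto (fun t : ℝ => A (x + t • w) w) (𝓝[>] 0) (𝓝 (A x w))) : A x = 0 := by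
  have hnonneg (w : V) : 0 ≤ A x w := by
    refine ge_of_tendsto (hcont w) ?_
    filter_upwards [self_mem_nhdsWithin] with t (ht : 0 < t)
    have h := hA (x + t • w) x
    rw [sub_add_cancel_left, map_neg, map_smul, smul_eq_mul] at h
    nlinarith [hmin (x + t • w)]
  ext w
  refine le_antisymm ?_ (hnonneg w)
  simpa using hnonneg (-w)

end Minimization

/-- By compactness of the unit sphere, which is covered by the increasing open sets
`{v | u v < n * d v}`. -/
theorem exists_le_mul_of_homogeneous {V : Type*} [NormedAddCommGroup V] [NormedSpace ℝ V]
    [ProperSpace V] {u d : V → ℝ} {p : ℝ} (hu : Continuous u) (hd : Continuous d)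
    (hup : ∀ t : ℝ, 0 < t → ∀ v, u (t • v) = t ^ p * u v)
    (hdp : ∀ t : ℝ, 0 < t → ∀ v, d (t • v) = t ^ p * d v) (hu0 : u 0 ≤ 0) (hd0 : ∀ v, 0 ≤ d v)
    (hneg : ∀ v ≠ 0, d v = 0 → u v < 0) :
    ∃ C, 0 < C ∧ ∀ v, u v ≤ C * d v := by
  obtain ⟨n, hn⟩ := (isCompact_sphere (0 : V) 1).elim_directed_cover
    (fun n : ℕ => {v | u v < n * d v}) (fun n => isOpen_lt hu (by fun_prop))
    (fun v hv => by
      rcases (hd0 v).eq_or_lt' with h0 | h0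
      · have hv0 : v ≠ 0 := ne_zero_of_mem_unit_sphere ⟨v, hv⟩
        simpa [h0] using hneg v hv0 h0
      · obtain ⟨n, hn⟩ := exists_nat_gt (u v / d v)
        exact Set.mem_iUnion.2 ⟨n, (div_lt_iff₀ h0).1 hn⟩)
    (directed_of_isDirected_le fun m n hmn v (hv : _ < _) =>
      hv.trans_le (mul_le_mul_of_nonneg_right (Nat.cast_le.2 hmn) (hd0 v)))
  refine ⟨n + 1, by positivity, fun v => ?_⟩
  rcases eq_or_ne v 0 with rfl | hv
  · exact hu0.trans (mul_nonneg (by positivity) (hd0 0))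
  · have hpos : 0 < ‖v‖ := norm_pos_iff.2 hv
    have hsphere : ‖v‖⁻¹ • v ∈ Metric.sphere (0 : V) 1 := by
      simp [norm_smul, hpos.ne']
    have h : u (‖v‖⁻¹ • v) < n * d (‖v‖⁻¹ • v) := hn hsphere
    rw [← smul_inv_smul₀ hpos.ne' v, hup _ hpos, hdp _ hpos, mul_left_comm]
    gcongr
    linarith [hd0 (‖v‖⁻¹ • v)]

section PowerDefect

variable {p : ℝ}

/-- The failure of midpoint linearity of `|x| ^ p`. -/
def rpowDefect (p a b : ℝ) : ℝ := (|a| ^ p + |b| ^ p) / 2 - |(a + b) / 2| ^ p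

theorem abs_add_div_two_rpow_le (hp : 0 ≤ p) (a b : ℝ) :
    |(a + b) / 2| ^ p ≤ ((1 / 2 : ℝ) • |a| + (1 / 2 : ℝ) • |b|) ^ p := by
  refine Real.rpow_le_rpow (abs_nonneg _) ?_ hp
  rw [abs_div, abs_two, smul_eq_mul, smul_eq_mul]
  linarith [abs_add_le a b]

theorem rpowDefect_nonneg (hp : 1 ≤ p) (a b : ℝ) : 0 ≤ rpowDefect p a b := by
  have hconv := (convexOn_rpow hp).2 (abs_nonneg a) (abs_nonneg b)
    one_half_pos.le one_half_pos.le (add_halves 1)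
  have hle := abs_add_div_two_rpow_le (zero_le_one.trans hp) a b
  simp only [smul_eq_mul] at hconv hle
  unfold rpowDefect
  linarith

theorem rpowDefect_pos (hp : 1 < p) {a b : ℝ} (hab : a ≠ b) : 0 < rpowDefect p a b := by
  have hp0 : 0 < p := one_pos.trans hp
  unfold rpowDefect
  by_cases h : |a| = |b|
  · obtain rfl : a = -b := (abs_eq_abs.1 h).resolve_left hab
    have hb : b ≠ 0 := by
      rintro rfl
      simp at hab
    have : 0 < |b| ^ p := Real.rpow_pos_of_pos (abs_pos.2 hb) _
    simp [Real.zero_rpow hp0.ne', this]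
  · have hconv := (strictConvexOn_rpow hp).2 (abs_nonneg a) (abs_nonneg b) h
      one_half_pos one_half_pos (add_halves 1)
    have hle := abs_add_div_two_rpow_le hp0.le a b
    simp only [smul_eq_mul] at hconv hle
    linarith

theorem rpowDefect_mul {t : ℝ} (ht : 0 ≤ t) (a b : ℝ) :
    rpowDefect p (t * a) (t * b) = t ^ p * rpowDefect p a b := by
  simp only [rpowDefect, ← mul_add, mul_div_assoc, abs_mul, abs_of_nonneg ht,
    Real.mul_rpow ht (abs_nonneg _)]
  ring

theorem exists_abs_sub_rpow_le (hp : 1 < p) {η : ℝ} (hη : 0 < η) :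
    ∃ C, 0 < C ∧ ∀ a b : ℝ, |a - b| ^ p ≤ η * (|a| ^ p + |b| ^ p) + C * rpowDefect p a b := by
  have hp0 : 0 < p := one_pos.trans hp
  have hcont {F : ℝ × ℝ → ℝ} (hF : Continuous F) : Continuous fun v => |F v| ^ p :=
    hF.abs.rpow_const fun _ => .inr hp0.le
  obtain ⟨C, hC, h⟩ := exists_le_mul_of_homogeneous (p := p)
    (u := fun v : ℝ × ℝ => |v.1 - v.2| ^ p - η * (|v.1| ^ p + |v.2| ^ p))
    (d := fun v => rpowDefect p v.1 v.2)
    ((hcont (by fun_prop)).sub (((hcont continuous_fst).add (hcont continuous_snd)).const_mul η))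
    ((((hcont continuous_fst).add (hcont continuous_snd)).div_const 2).sub (hcont (by fun_prop)))
    (fun t ht v => by
      simp only [Prod.smul_fst, Prod.smul_snd, smul_eq_mul, ← mul_sub, abs_mul, abs_of_pos ht,
        Real.mul_rpow ht.le (abs_nonneg _)]
      ring)
    (fun t ht v => rpowDefect_mul ht.le _ _)
    (by simp [Real.zero_rpow hp0.ne'])
    (fun v => rpowDefect_nonneg hp.le _ _)
    (by
      rintro ⟨a, b⟩ hv hd
      obtain rfl : a = b := by_contra fun hab => (rpowDefect_pos hp hab).ne' hd
      have ha : a ≠ 0 := by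
        rintro rfl
        exact hv rfl
      have : 0 < |a| ^ p := Real.rpow_pos_of_pos (abs_pos.2 ha) _
      simp only [sub_self, abs_zero, Real.zero_rpow hp0.ne', zero_sub, neg_lt_zero]
      positivity)
  exact ⟨C, hC, fun a b => sub_le_iff_le_add'.1 (h (a, b))⟩

end PowerDefect

section AbsRpowDeriv

variable {p : ℝ}

/-- The derivative of `|x| ^ p / p`. -/
def absRpowDeriv (p x : ℝ) : ℝ := |x| ^ (p - 2) * x

theorem absRpowDeriv_mul_self (hp : p ≠ 0) (x : ℝ) : absRpowDeriv p x * x = |x| ^ p := by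
  rcases eq_or_ne x 0 with rfl | hx
  · simp [Real.zero_rpow hp]
  · rw [absRpowDeriv, mul_assoc, ← abs_mul_abs_self x, ← pow_two,
      ← Real.rpow_add_natCast (abs_ne_zero.2 hx)]
    norm_num

theorem abs_absRpowDeriv (hp : p ≠ 1) (x : ℝ) : |absRpowDeriv p x| = |x| ^ (p - 1) := by
  rcases eq_or_ne x 0 with rfl | hx
  · simp [absRpowDeriv, Real.zero_rpow (sub_ne_zero.2 hp)]
  · rw [absRpowDeriv, abs_mul, Real.abs_rpow_of_nonneg (abs_nonneg x), abs_abs,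
      ← Real.rpow_add_one (abs_ne_zero.2 hx)]
    ring_nf

theorem abs_absRpowDeriv_add_mul_le (hp : 1 < p) {t : ℝ} (ht : t ∈ Set.Icc 0 1) (a b : ℝ) :
    |absRpowDeriv p (a + t * b) * b| ≤ |(|a| + |b|)| ^ p := by
  have hab : |a + t * b| ≤ |(|a| + |b|)| := by
    refine (abs_add_le _ _).trans ((add_le_add_right ?_ _).trans (le_abs_self _))
    rw [abs_mul, abs_of_nonneg ht.1]
    exact mul_le_of_le_one_left (abs_nonneg b) ht.2
  have hb : |b| ≤ |(|a| + |b|)| :=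
    (le_add_of_nonneg_left (abs_nonneg a)).trans (le_abs_self _)
  calc |absRpowDeriv p (a + t * b) * b|
      ≤ |(|a| + |b|)| ^ (p - 1) * |(|a| + |b|)| := by
        rw [abs_mul, abs_absRpowDeriv hp.ne']
        exact mul_le_mul (Real.rpow_le_rpow (abs_nonneg _) hab (sub_nonneg.2 hp.le)) hb
          (abs_nonneg b) (by positivity)
    _ = |(|a| + |b|)| ^ p := by
        rw [← abs_absRpowDeriv hp.ne', ← abs_mul, absRpowDeriv_mul_self (one_pos.trans hp).ne',
          Real.abs_rpow_of_nonneg (abs_nonneg _), abs_abs]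

theorem continuous_absRpowDeriv (hp : 1 < p) : Continuous (absRpowDeriv p) := by
  have hderiv (x : ℝ) : p⁻¹ * deriv (fun x : ℝ => ‖x‖ ^ p) x = absRpowDeriv p x := by
    rw [absRpowDeriv, (hasDerivAt_norm_rpow x hp).deriv, mul_assoc,
      inv_mul_cancel_left₀ (by positivity), Real.norm_eq_abs]
  exact (((contDiff_norm_rpow (E := ℝ) hp).continuous_deriv le_rfl).const_mul p⁻¹).congr hderiv

end AbsRpowDeriv

section Duality

open Filter Topology

variable {α : Type*} [MeasurableSpace α] {μ : Measure α} {p : ℝ}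

theorem holderConjugate_conjExponent [hp : Fact (1 < p)] : p.HolderConjugate p.conjExponent :=
  .conjExponent hp.out

instance [hp : Fact (1 < p)] : Fact (1 ≤ ENNReal.ofReal p) :=
  ⟨ENNReal.one_le_ofReal.2 hp.out.le⟩

instance [Fact (1 < p)] : Fact (1 ≤ ENNReal.ofReal p.conjExponent) :=
  ⟨ENNReal.one_le_ofReal.2 holderConjugate_conjExponent.symm.lt.le⟩

instance [Fact (1 < p)] :
    (ENNReal.ofReal p.conjExponent).HolderConjugate (ENNReal.ofReal p) :=
  holderConjugate_conjExponent.symm.ennrealOfReal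

variable [hp : Fact (1 < p)]

theorem norm_rpow_eq_integral (f : Lp ℝ (.ofReal p) μ) : ‖f‖ ^ p = ∫ x, |f x| ^ p ∂μ := by
  have hp0 : 0 < p := one_pos.trans hp.out
  rw [Lp.norm_def, toReal_eLpNorm (Lp.aestronglyMeasurable f),
    lpNorm_eq_integral_norm_rpow_toReal (ENNReal.ofReal_ne_zero_iff.2 hp0) ENNReal.ofReal_ne_top
      (Lp.aestronglyMeasurable f), ENNReal.toReal_ofReal hp0.le,
    Real.rpow_inv_rpow (integral_nonneg fun x => by positivity) hp0.ne']
  simp only [Real.norm_eq_abs]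

theorem integrable_abs_rpow {f : α → ℝ} (hf : MemLp f (.ofReal p) μ) :
    Integrable (fun x => |f x| ^ p) μ := by
  have hp0 : 0 < p := one_pos.trans hp.out
  simpa [ENNReal.toReal_ofReal hp0.le] using
    hf.integrable_norm_rpow (ENNReal.ofReal_ne_zero_iff.2 hp0) ENNReal.ofReal_ne_top

/-- The pairing of `L^q` with `L^p`, where `q` is the conjugate exponent of `p`. -/
def dualPairing : Lp ℝ (.ofReal p.conjExponent) μ →L[ℝ] Lp ℝ (.ofReal p) μ →L[ℝ] ℝ :=
  (ContinuousLinearMap.mul ℝ ℝ).lpPairing μ _ _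

theorem dualPairing_eq_integral (g : Lp ℝ (.ofReal p.conjExponent) μ) (f : Lp ℝ (.ofReal p) μ) :
    dualPairing g f = ∫ x, g x * f x ∂μ :=
  ContinuousLinearMap.lpPairing_eq_integral _ g f

theorem dualPairing_le (g : Lp ℝ (.ofReal p.conjExponent) μ) (f : Lp ℝ (.ofReal p) μ) :
    dualPairing g f ≤ ‖g‖ * ‖f‖ := by
  have hprod := (ContinuousLinearMap.mul ℝ ℝ).norm_holder_apply_apply_le (r := 1) g f
  rw [ContinuousLinearMap.opNorm_mul, one_mul] at hprod
  have heq : dualPairing g f = L1.integral ((ContinuousLinearMap.mul ℝ ℝ).holder 1 g f) := by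
    simp [dualPairing, ContinuousLinearMap.lpPairing, ← L1.integral_eq']
  exact heq ▸ (le_abs_self _).trans ((L1.norm_integral_le _).trans hprod)

theorem memLp_absRpowDeriv {f : α → ℝ} (hf : MemLp f (.ofReal p) μ) :
    MemLp (fun x => absRpowDeriv p (f x)) (.ofReal p.conjExponent) μ := by
  have hps := holderConjugate_conjExponent (p := p)
  rw [← integrable_norm_rpow_iff ((continuous_absRpowDeriv hp.out).comp_aestronglyMeasurable hf.1)
    (by simpa using hps.symm.pos) ENNReal.ofReal_ne_top, ENNReal.toReal_ofReal hps.symm.nonneg]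
  simpa only [Real.norm_eq_abs, abs_absRpowDeriv hps.lt.ne', ← Real.rpow_mul (abs_nonneg _),
    hps.sub_one_mul_conj] using integrable_abs_rpow hf

/-- The duality map of `L^p`: the derivative of `‖f‖ ^ p / p`, as an element of the dual space. -/
def dualityMap (f : Lp ℝ (.ofReal p) μ) : Lp ℝ (.ofReal p.conjExponent) μ :=
  (memLp_absRpowDeriv (Lp.memLp f)).toLp _

theorem coeFn_dualityMap (f : Lp ℝ (.ofReal p) μ) :
    dualityMap f =ᵐ[μ] fun x => absRpowDeriv p (f x) :=
  (memLp_absRpowDeriv (Lp.memLp f)).coeFn_toLp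

theorem dualPairing_dualityMap (f w : Lp ℝ (.ofReal p) μ) :
    dualPairing (dualityMap f) w = ∫ x, absRpowDeriv p (f x) * w x ∂μ := by
  rw [dualPairing_eq_integral]
  refine integral_congr_ae ?_
  filter_upwards [coeFn_dualityMap f] with x hx
  rw [hx]

theorem dualPairing_dualityMap_self (f : Lp ℝ (.ofReal p) μ) :
    dualPairing (dualityMap f) f = ‖f‖ ^ p := by
  simp only [dualPairing_dualityMap, absRpowDeriv_mul_self (one_pos.trans hp.out).ne',
    norm_rpow_eq_integral]

theorem norm_dualityMap (f : Lp ℝ (.ofReal p) μ) : ‖dualityMap f‖ = ‖f‖ ^ (p - 1) := by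
  have hps := holderConjugate_conjExponent (p := p)
  have : Fact (1 < p.conjExponent) := ⟨hps.symm.lt⟩
  rw [← Real.rpow_left_inj (norm_nonneg _) (by positivity) hps.symm.ne_zero,
    ← Real.rpow_mul (norm_nonneg _), hps.sub_one_mul_conj, norm_rpow_eq_integral,
    norm_rpow_eq_integral]
  refine integral_congr_ae ?_
  filter_upwards [coeFn_dualityMap f] with x hx
  rw [hx, abs_absRpowDeriv hps.lt.ne', ← Real.rpow_mul (abs_nonneg _), hps.sub_one_mul_conj]

theorem norm_rpow_smul_dualityMap_le {f : Lp ℝ (.ofReal p) μ} {δ : ℝ} (hδ : 0 < δ)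
    (hf : δ * ‖f‖ ≤ 1) : ‖δ ^ p • dualityMap f‖ ≤ δ :=
  calc ‖δ ^ p • dualityMap f‖ = δ * (δ * ‖f‖) ^ (p - 1) := by
        rw [norm_smul, norm_dualityMap, Real.norm_of_nonneg (by positivity),
          Real.mul_rpow hδ.le (norm_nonneg f), ← mul_assoc, Real.rpow_sub_one hδ.ne',
          mul_div_cancel₀ _ hδ.ne']
    _ ≤ δ := mul_le_of_le_one_right hδ.le <|
        Real.rpow_le_one (by positivity) hf (sub_nonneg.2 (Fact.out : 1 < p).le)

theorem norm_rpow_div_add_dualPairing_le (f w : Lp ℝ (.ofReal p) μ) :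
    ‖f‖ ^ p / p + dualPairing (dualityMap f) (w - f) ≤ ‖w‖ ^ p / p := by
  have hps := holderConjugate_conjExponent (p := p)
  have hyoung := Real.young_inequality_of_nonneg (norm_nonneg w) (norm_nonneg (dualityMap f)) hps
  rw [norm_dualityMap, ← Real.rpow_mul (norm_nonneg _), hps.sub_one_mul_conj] at hyoung
  have hle := dualPairing_le (dualityMap f) w
  have hinv : ‖f‖ ^ p / p + ‖f‖ ^ p / p.conjExponent = ‖f‖ ^ p := by
    rw [div_eq_mul_inv, div_eq_mul_inv, ← mul_add, hps.inv_add_inv_eq_one, mul_one]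
  rw [norm_dualityMap] at hle
  rw [map_sub, dualPairing_dualityMap_self]
  linarith

theorem tendsto_dualPairing_dualityMap (f w : Lp ℝ (.ofReal p) μ) :
    Tendsto (fun t : ℝ => dualPairing (dualityMap (f + t • w)) w) (𝓝[>] 0)
      (𝓝 (dualPairing (dualityMap f) w)) := by
  have hline (t : ℝ) : dualPairing (dualityMap (f + t • w)) w =
      ∫ x, absRpowDeriv p (f x + t * w x) * w x ∂μ := by
    rw [dualPairing_dualityMap]
    refine integral_congr_ae ?_
    filter_upwards [Lp.coeFn_add f (t • w), Lp.coeFn_smul t w] with x hadd hsmul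
    simp only [hadd, Pi.add_apply, hsmul, Pi.smul_apply, smul_eq_mul]
  have hcont := continuous_absRpowDeriv hp.out
  simp only [hline, dualPairing_dualityMap]
  refine tendsto_integral_filter_of_dominated_convergence
    (fun x => |(|f x| + |w x|)| ^ p) ?_ ?_ ?_ ?_
  · exact .of_forall fun t => (hcont.comp_aestronglyMeasurable ((Lp.aestronglyMeasurable f).add
      ((Lp.aestronglyMeasurable w).const_mul t))).mul (Lp.aestronglyMeasurable w)
  · filter_upwards [Ioc_mem_nhdsGT one_pos] with t ht
    exact .of_forall fun x => abs_absRpowDeriv_add_mul_le hp.out (Set.Ioc_subset_Icc_self ht) _ _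
  · exact integrable_abs_rpow ((Lp.memLp f).abs.add (Lp.memLp w).abs)
  · refine .of_forall fun x => ?_
    have : Continuous fun t => absRpowDeriv p (f x + t * w x) * w x := by fun_prop
    simpa using (this.tendsto 0).mono_left nhdsWithin_le_nhds

end Duality

section VariationalPrinciple

open Filter Topology

variable {α : Type*} [MeasurableSpace α] {μ : Measure α} {p : ℝ} [hp : Fact (1 < p)]

theorem exists_norm_sub_rpow_le (μ : Measure α) {η : ℝ} (hη : 0 < η) :
    ∃ C, 0 < C ∧ ∀ f g : Lp ℝ (.ofReal p) μ, ‖f - g‖ ^ p ≤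
      η * (‖f‖ ^ p + ‖g‖ ^ p) + C * ((‖f‖ ^ p + ‖g‖ ^ p) / 2 - ‖midpoint ℝ f g‖ ^ p) := by
  obtain ⟨C, hC, h⟩ := exists_abs_sub_rpow_le hp.out hη
  refine ⟨C, hC, fun f g => ?_⟩
  have hf := integrable_abs_rpow (Lp.memLp f)
  have hg := integrable_abs_rpow (Lp.memLp g)
  have hmid := integrable_abs_rpow (Lp.memLp (midpoint ℝ f g))
  have hsum : Integrable (fun x => |f x| ^ p + |g x| ^ p) μ := hf.add hg
  have hmean : Integrable (fun x => (|f x| ^ p + |g x| ^ p) / 2) μ := hsum.div_const 2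
  have hdefect : Integrable
      (fun x => C * ((|f x| ^ p + |g x| ^ p) / 2 - |midpoint ℝ f g x| ^ p)) μ :=
    (hmean.sub hmid).const_mul C
  calc ‖f - g‖ ^ p = ∫ x, |(f - g) x| ^ p ∂μ := norm_rpow_eq_integral _
    _ ≤ ∫ x, (η * (|f x| ^ p + |g x| ^ p) +
          C * ((|f x| ^ p + |g x| ^ p) / 2 - |midpoint ℝ f g x| ^ p)) ∂μ := by
        refine integral_mono_ae (integrable_abs_rpow (Lp.memLp _))
          ((hsum.const_mul η).add hdefect) ?_
        filter_upwards [Lp.coeFn_sub f g, Lp.coeFn_smul (⅟2 : ℝ) (f + g), Lp.coeFn_add f g]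
          with x hsub hsmul hadd
        have hmidpoint : midpoint ℝ f g x = (f x + g x) / 2 := by
          rw [midpoint_eq_smul_add, hsmul, Pi.smul_apply, hadd, Pi.add_apply, smul_eq_mul,
            invOf_eq_inv, inv_mul_eq_div]
        rw [hsub, Pi.sub_apply, hmidpoint]
        exact h (f x) (g x)
    _ = _ := by
        simp only [norm_rpow_eq_integral]
        rw [integral_add (hsum.const_mul η) hdefect, integral_const_mul, integral_const_mul,
          integral_sub hmean hmid, integral_div, integral_add hf hg]

theorem exists_mul_le_mul_rpow_add {c : ℝ} (hc : 0 < c) {b : ℝ} (hb : 0 ≤ b) :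
    ∃ K, ∀ r : ℝ, 0 ≤ r → b * r ≤ c * (r ^ p / p) + K := by
  have hps := holderConjugate_conjExponent (p := p)
  have hroot : 0 < c ^ p⁻¹ := by positivity
  refine ⟨(b / c ^ p⁻¹) ^ p.conjExponent / p.conjExponent, fun r hr => ?_⟩
  have h := Real.young_inequality_of_nonneg (mul_nonneg hroot.le hr) (div_nonneg hb hroot.le) hps
  rw [Real.mul_rpow hroot.le hr, Real.rpow_inv_rpow hc.le hps.ne_zero] at h
  calc b * r = c ^ p⁻¹ * r * (b / c ^ p⁻¹) := by field_simp
    _ ≤ _ := h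
    _ = _ := by ring

variable {Ψ : Lp ℝ (.ofReal p) μ → ℝ} {A : Lp ℝ (.ofReal p) μ → Lp ℝ (.ofReal p) μ →L[ℝ] ℝ}

theorem exists_norm_le_add_norm_rpow (hA : ∀ f w, Ψ f + A f (w - f) ≤ Ψ w) {c : ℝ} (hc : 0 < c) :
    ∃ K, ∀ f, ‖f‖ ≤ Ψ f + c * (‖f‖ ^ p / p) + K := by
  obtain ⟨K, hK⟩ := exists_mul_le_mul_rpow_add (p := p) hc (b := ‖A 0‖ + 1) (by positivity)
  refine ⟨K - Ψ 0, fun f => ?_⟩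
  have hsub := hA 0 f
  rw [sub_zero] at hsub
  linarith [hK ‖f‖ (norm_nonneg f), neg_le_of_abs_le ((A 0).le_opNorm f)]

theorem exists_forall_add_norm_rpow_le (hΨ : Continuous Ψ)
    (hA : ∀ f w, Ψ f + A f (w - f) ≤ Ψ w) {c : ℝ} (hc : 0 < c) :
    ∃ f, ∀ w, Ψ f + c * (‖f‖ ^ p / p) ≤ Ψ w + c * (‖w‖ ^ p / p) := by
  have hp0 : 0 < p := one_pos.trans hp.out
  obtain ⟨K, hK⟩ := exists_norm_le_add_norm_rpow hA hc
  refine exists_forall_le_of_uniform_midpoint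
    (hΨ.add (((continuous_norm.rpow_const fun _ => .inr hp0.le).div_const p).const_mul c))
    ⟨-K, Set.forall_mem_range.2 fun f => by linarith [hK f, norm_nonneg f]⟩ fun ε hε R => ?_
  have hεp : 0 < ε ^ p := by positivity
  set M := |R + K| ^ p
  have : 0 ≤ M := by positivity
  have hbound (f : Lp ℝ (.ofReal p) μ) (hf : Ψ f + c * (‖f‖ ^ p / p) ≤ R) : ‖f‖ ^ p ≤ M :=
    Real.rpow_le_rpow (norm_nonneg f) (by linarith [hK f, le_abs_self (R + K)]) hp0.le
  obtain ⟨C, hC, hdefect⟩ := exists_norm_sub_rpow_le (p := p) μ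
    (η := ε ^ p / (4 * (M + 1))) (by positivity)
  refine ⟨c / p * (ε ^ p / (2 * C)), by positivity, fun f g hf hg hfg => ?_⟩
  have hsum : ε ^ p / (4 * (M + 1)) * (‖f‖ ^ p + ‖g‖ ^ p) ≤ ε ^ p / 2 := by
    rw [div_mul_eq_mul_div, div_le_div_iff₀ (by positivity) two_pos]
    nlinarith [hbound f hf, hbound g hg]
  have hgap : ε ^ p / (2 * C) ≤ (‖f‖ ^ p + ‖g‖ ^ p) / 2 - ‖midpoint ℝ f g‖ ^ p := by
    rw [div_le_iff₀ (by positivity)]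
    linarith [hdefect f g, Real.rpow_le_rpow hε.le hfg hp0.le]
  have hmid := two_mul_midpoint_le_of_subgradient hA f g
  have hscaled := mul_le_mul_of_nonneg_left hgap (div_nonneg hc.le hp0.le)
  have hscaled' : c / p * ((‖f‖ ^ p + ‖g‖ ^ p) / 2 - ‖midpoint ℝ f g‖ ^ p) =
      (c * (‖f‖ ^ p / p) + c * (‖g‖ ^ p / p)) / 2 - c * (‖midpoint ℝ f g‖ ^ p / p) := by ring
  linarith

theorem exists_add_dualityMap_eq_zero (hΨ : Continuous Ψ) (hA : ∀ f w, Ψ f + A f (w - f) ≤ Ψ w)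
    (hAcont : ∀ f w, Tendsto (fun t : ℝ => A (f + t • w) w) (𝓝[>] 0) (𝓝 (A f w))) {c : ℝ}
    (hc : 0 < c) : ∃ f, A f + c • dualPairing (dualityMap f) = 0 := by
  obtain ⟨f, hf⟩ := exists_forall_add_norm_rpow_le hΨ hA hc
  refine ⟨f, subgradient_eq_zero_of_forall_le
    (Φ := fun u => Ψ u + c * (‖u‖ ^ p / p)) (A := fun u => A u + c • dualPairing (dualityMap u))
    (fun u w => ?_) hf fun w =>
    (hAcont f w).add ((tendsto_dualPairing_dualityMap f w).const_mul c)⟩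
  have hnorm := mul_le_mul_of_nonneg_left (norm_rpow_div_add_dualPairing_le u w) hc.le
  rw [add_apply, smul_apply, smul_eq_mul]
  linarith [hA u w]

end VariationalPrinciple

section CubeMeasure

variable {G : Type*} [MeasurableSpace G] {μ : Measure G} {k : ℕ}

variable (μ k) in
/-- The product measure on the space of `k`-dimensional cubes; a cube with sides
`h = (h_1, …, h_k)` and base point `x` is encoded as the pair `(h, x)`. -/
abbrev cubeMeasure : Measure ((Fin k → G) × G) := (Measure.pi fun _ => μ).prod μ

variable (G k) in
/-- The measurable equivalence `(h, (H, x)) ↦ (Fin.cons h H, x)`, which splits off the first side of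
a cube. -/
def cubeConsEquiv : G × ((Fin k → G) × G) ≃ᵐ (Fin (k + 1) → G) × G :=
  MeasurableEquiv.prodAssoc.symm.trans
    ((MeasurableEquiv.piFinSuccAbove (fun _ => G) 0).symm.prodCongr (.refl G))

theorem cubeConsEquiv_apply (h x : G) (H : Fin k → G) :
    cubeConsEquiv G k (h, (H, x)) = (Fin.cons h H, x) :=
  Prod.ext (Fin.insertNth_zero' h H) rfl

theorem measurePreserving_cubeConsEquiv [SigmaFinite μ] :
    MeasurePreserving (cubeConsEquiv G k) (μ.prod (cubeMeasure μ k)) (cubeMeasure μ (k + 1)) :=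
  ((measurePreserving_prodAssoc μ (Measure.pi fun _ => μ) μ).symm MeasurableEquiv.prodAssoc).trans
    (((measurePreserving_piFinSuccAbove (fun _ => μ) 0).symm _).prod (.id μ))

theorem measurePreserving_snd_cubeMeasure_zero [SigmaFinite μ] :
    MeasurePreserving Prod.snd (cubeMeasure μ 0) μ :=
  have : IsProbabilityMeasure (Measure.pi fun _ : Fin 0 => μ) := ⟨Measure.pi_empty_univ _⟩
  measurePreserving_snd

end CubeMeasure

section CubeProducts

variable {G : Type*} [AddCommGroup G] {k : ℕ}

/-- The vertex `x + α · h` of the cube `(h, x)`. -/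
def vertex (α : Fin k → Fin 2) (z : (Fin k → G) × G) : G := z.2 + ∑ i, (α i : ℕ) • z.1 i

/-- The product over the vertices of a cube of a family of functions indexed by the vertices. -/
def vertexProd (F : (Fin k → Fin 2) → G → ℝ) (z : (Fin k → G) × G) : ℝ := ∏ α, F α (vertex α z)

/-- The product of `f` over all vertices of a cube except the base point. -/
def puncturedProd (f : G → ℝ) (z : (Fin k → G) × G) : ℝ :=
  ∏ α ∈ Finset.univ.erase (0 : Fin k → Fin 2), f (vertex α z)

/-- The multiplicative derivative `x ↦ f (x + h) * w x` of a pair of functions. -/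
def shiftMul (h : G) (f w : G → ℝ) (x : G) : ℝ := f (x + h) * w x

/-- The family on the `k`-dimensional cube obtained from a family on the `(k + 1)`-dimensional cube
by multiplying together the two ends of each edge in the first direction, whose side is `h`. -/
def edgeMul (h : G) (F : (Fin (k + 1) → Fin 2) → G → ℝ) (β : Fin k → Fin 2) : G → ℝ :=
  shiftMul h (F (Fin.cons 1 β)) (F (Fin.cons 0 β))

theorem vertex_zero (z : (Fin k → G) × G) : vertex 0 z = z.2 := by simp [vertex]

theorem vertex_cons_zero (β : Fin k → Fin 2) (h x : G) (H : Fin k → G) :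
    vertex (Fin.cons 0 β) (Fin.cons h H, x) = vertex β (H, x) := by
  simp [vertex, Fin.sum_univ_succ]

theorem vertex_cons_one (β : Fin k → Fin 2) (h x : G) (H : Fin k → G) :
    vertex (Fin.cons 1 β) (Fin.cons h H, x) = vertex β (H, x) + h := by
  simp only [vertex, Fin.sum_univ_succ, Fin.cons_zero, Fin.cons_succ, Fin.val_one, one_smul]
  abel

theorem vertex_add (α : Fin k → Fin 2) (h x : G) (H : Fin k → G) :
    vertex α (H, x + h) = vertex α (H, x) + h :=
  add_right_comm _ _ _

theorem prod_cube_succ {M : Type*} [CommMonoid M] (a : (Fin (k + 1) → Fin 2) → M) :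
    ∏ α, a α = ∏ β : Fin k → Fin 2, a (Fin.cons 1 β) * a (Fin.cons 0 β) := by
  rw [← (Fin.consEquiv fun _ : Fin (k + 1) => Fin 2).prod_comp, Fintype.prod_prod_type_right]
  exact Finset.prod_congr rfl fun β _ => (Fin.prod_univ_two _).trans (mul_comm _ _)

theorem sum_cube_succ {M : Type*} [AddCommMonoid M] (a : (Fin (k + 1) → Fin 2) → M) :
    ∑ α, a α = ∑ β : Fin k → Fin 2, (a (Fin.cons 1 β) + a (Fin.cons 0 β)) :=
  prod_cube_succ (M := Multiplicative M) a

theorem vertexProd_zero (F : (Fin 0 → Fin 2) → G → ℝ) : vertexProd F = F 0 ∘ Prod.snd :=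
  funext fun z => (Fintype.prod_subsingleton _ 0).trans (congrArg (F 0) (vertex_zero z))

theorem lintegral_enorm_vertexProd_zero [MeasurableSpace G] {μ : Measure G} [SigmaFinite μ]
    {F : (Fin 0 → Fin 2) → G → ℝ} (hF : AEStronglyMeasurable (F 0) μ) :
    ∫⁻ z, ‖vertexProd F z‖ₑ ∂cubeMeasure μ 0 = ∫⁻ x, ‖F 0 x‖ₑ ∂μ := by
  have hsnd := measurePreserving_snd_cubeMeasure_zero (μ := μ)
  rw [← hsnd.map_eq] at hF
  simp only [vertexProd_zero, Function.comp_apply]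
  rw [← lintegral_map' hF.enorm hsnd.aemeasurable, hsnd.map_eq]

theorem vertexProd_cons (F : (Fin (k + 1) → Fin 2) → G → ℝ) (h x : G) (H : Fin k → G) :
    vertexProd F (Fin.cons h H, x) = vertexProd (edgeMul h F) (H, x) := by
  simp only [vertexProd, prod_cube_succ, vertex_cons_zero, vertex_cons_one, edgeMul, shiftMul]

theorem vertexProd_cubeConsEquiv [MeasurableSpace G] (F : (Fin (k + 1) → Fin 2) → G → ℝ) (h : G)
    (z : (Fin k → G) × G) :
    vertexProd F (cubeConsEquiv G k (h, z)) = vertexProd (edgeMul h F) z := by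
  rw [cubeConsEquiv_apply, vertexProd_cons]

theorem vertexProd_update (F : (Fin k → Fin 2) → G → ℝ) (α : Fin k → Fin 2) (w : G → ℝ)
    (z : (Fin k → G) × G) : vertexProd (Function.update F α w) z =
      w (vertex α z) * ∏ β ∈ Finset.univ.erase α, F β (vertex β z) := by
  rw [vertexProd, ← Finset.mul_prod_erase _ _ (Finset.mem_univ α), Function.update_self]
  congr 1
  refine Finset.prod_congr rfl fun β hβ => ?_
  rw [Function.update_of_ne (Finset.ne_of_mem_erase hβ)]

theorem vertexProd_update_zero (f w : G → ℝ) (z : (Fin k → G) × G) :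
    vertexProd (Function.update (fun _ => f) 0 w) z = w z.2 * puncturedProd f z := by
  rw [vertexProd_update, vertex_zero, puncturedProd]

theorem vertexProd_shiftMul (h x : G) (H : Fin k → G) (f w : G → ℝ) :
    vertexProd (fun _ => shiftMul h f w) (H, x) =
      vertexProd (fun _ => w) (H, x) * vertexProd (fun _ => f) (H, x + h) := by
  simp only [vertexProd, shiftMul, Finset.prod_mul_distrib, vertex_add, mul_comm]

end CubeProducts

section Measurability

variable {G : Type*} [AddCommGroup G] [MeasurableSpace G] [MeasurableAdd₂ G] {μ : Measure G}
  [μ.IsAddLeftInvariant] {k : ℕ}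

theorem aestronglyMeasurable_shiftMul {f w : G → ℝ} (hf : AEStronglyMeasurable f μ)
    (hw : AEStronglyMeasurable w μ) (h : G) : AEStronglyMeasurable (shiftMul h f w) μ :=
  (hf.comp_quasiMeasurePreserving (measurePreserving_add_right μ h).quasiMeasurePreserving).mul hw

variable [SigmaFinite μ]

theorem aestronglyMeasurable_uncurry_shiftMul {f w : G → ℝ} (hf : AEStronglyMeasurable f μ)
    (hw : AEStronglyMeasurable w μ) :
    AEStronglyMeasurable (fun p : G × G => shiftMul p.1 f w p.2) (μ.prod μ) :=
  (hf.comp_quasiMeasurePreserving (Measure.quasiMeasurePreserving_snd.comp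
    (measurePreserving_prod_add_swap μ μ).quasiMeasurePreserving)).mul hw.comp_snd

theorem quasiMeasurePreserving_vertex (α : Fin k → Fin 2) :
    Measure.QuasiMeasurePreserving (vertex α) (cubeMeasure μ k) μ := by
  have hskew : MeasurePreserving (fun z : (Fin k → G) × G => (z.1, (∑ i, (α i : ℕ) • z.1 i) + z.2))
      (cubeMeasure μ k) (cubeMeasure μ k) :=
    (MeasurePreserving.id _).skew_product
      (g := fun (H : Fin k → G) (x : G) => (∑ i, (α i : ℕ) • H i) + x)
      (by simp only [Function.uncurry_def]; fun_prop) (.of_forall fun H => map_add_left_eq_self μ _)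
  convert! Measure.quasiMeasurePreserving_snd.comp hskew.quasiMeasurePreserving using 1
  exact funext fun z => add_comm _ _

theorem aestronglyMeasurable_vertexProd {F : (Fin k → Fin 2) → G → ℝ}
    (hF : ∀ α, AEStronglyMeasurable (F α) μ) :
    AEStronglyMeasurable (vertexProd F) (cubeMeasure μ k) :=
  Finset.aestronglyMeasurable_fun_prod _ fun α _ =>
    (hF α).comp_quasiMeasurePreserving (quasiMeasurePreserving_vertex α)

theorem vertexProd_congr_ae {F F' : (Fin k → Fin 2) → G → ℝ} (h : ∀ α, F α =ᵐ[μ] F' α) :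
    vertexProd F =ᵐ[cubeMeasure μ k] vertexProd F' := by
  filter_upwards [ae_all_iff.2 fun α => (quasiMeasurePreserving_vertex α).ae (h α)] with z hz
  exact Finset.prod_congr rfl fun α _ => hz α

/-- The change of variables `(h, (H, x)) ↦ (H, (x, x + h))` turns a correlation of two functions
into a product of two integrals. -/
theorem measurePreserving_cube_regroup :
    MeasurePreserving (fun q : G × ((Fin k → G) × G) => (q.2.1, (q.2.2, q.2.2 + q.1)))
      (μ.prod (cubeMeasure μ k)) ((Measure.pi fun _ => μ).prod (μ.prod μ)) :=
  (((MeasurePreserving.id _).prod (measurePreserving_prod_add μ μ)).comp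
    (measurePreserving_prodAssoc _ μ μ)).comp Measure.measurePreserving_swap

end Measurability

section Exponents

theorem pExp_pos (k : ℕ) : 0 < pExp k := by
  unfold pExp
  positivity

theorem pExp_zero : pExp 0 = 1 := by simp [pExp]

theorem pExp_succ (k : ℕ) :
    pExp k = pExp (k + 1) * (((k : ℝ) + 1 + 1) / (2 * (k + 1))) := by
  unfold pExp
  push_cast
  field_simp
  ring

theorem one_lt_pExp {k : ℕ} (hk : 2 ≤ k) : 1 < pExp k := by
  have h : k + 1 < 2 ^ k := by
    induction k, hk using Nat.le_induction with
    | base => norm_num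
    | succ n _ ih => rw [pow_succ]; omega
  rw [pExp, one_lt_div (by positivity)]
  exact_mod_cast h

theorem holderConjugate_pExp_sExp {k : ℕ} (hk : 2 ≤ k) : (pExp k).HolderConjugate (sExp k) := by
  rw [Real.holderConjugate_iff_eq_conjExponent (one_lt_pExp hk)]
  have h := one_lt_pExp hk
  rw [pExp, one_lt_div (by positivity)] at h
  have hsub : (2 : ℝ) ^ k - k - 1 ≠ 0 := by linarith
  have hsub' : (2 : ℝ) ^ k - (k + 1) ≠ 0 := by linarith
  unfold pExp sExp
  field_simp
  ring

theorem pExp_mul (k : ℕ) : pExp k * ((k : ℝ) + 1) = 2 ^ k := by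
  unfold pExp
  field_simp

theorem lintegral_enorm_rpow {α : Type*} [MeasurableSpace α] {μ : Measure α} {p : ℝ} (hp : 0 < p)
    (f : α → ℝ) : ∫⁻ x, ‖f x‖ₑ ^ p ∂μ = eLpNorm f (.ofReal p) μ ^ p := by
  rw [eLpNorm_eq_lintegral_rpow_enorm_toReal (by simpa using hp) ENNReal.ofReal_ne_top,
    ENNReal.toReal_ofReal hp.le, ← ENNReal.rpow_mul, one_div_mul_cancel hp.ne', ENNReal.rpow_one]

end Exponents

section Young

variable {G : Type*} [AddCommGroup G] [MeasurableSpace G] [MeasurableAdd₂ G] {μ : Measure G}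
  [μ.IsAddLeftInvariant] {a b : G → ℝ≥0∞}

/-- Hölder's inequality for the splitting `(ab)^θ = (ab)^(1/r) a^t b^t`, where
`θ = (r + 1) / (2r)` and `1/r + 2t = 1`. -/
theorem lintegral_add_mul_rpow_le (ha : AEMeasurable a μ) (hb : AEMeasurable b μ) {r : ℝ}
    (hr : 1 ≤ r) (h : G) :
    ∫⁻ x, (b (x + h) * a x) ^ ((r + 1) / (2 * r)) ∂μ ≤
      (∫⁻ x, b (x + h) * a x ∂μ) ^ (1 / r) *
        ((∫⁻ x, a x ∂μ) * ∫⁻ x, b x ∂μ) ^ ((r - 1) / (2 * r)) := by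
  have hr0 : 0 < r := one_pos.trans_le hr
  have ht : 0 ≤ (r - 1) / (2 * r) := div_nonneg (sub_nonneg.2 hr) (by positivity)
  have hbh : AEMeasurable (fun x => b (x + h)) μ :=
    hb.comp_quasiMeasurePreserving (measurePreserving_add_right μ h).quasiMeasurePreserving
  have hölder := ENNReal.lintegral_prod_norm_pow_le (μ := μ) Finset.univ
    (f := ![fun x => b (x + h) * a x, a, fun x => b (x + h)])
    (p := ![1 / r, (r - 1) / (2 * r), (r - 1) / (2 * r)])
    (by intro i _; fin_cases i <;> [exact hbh.mul ha; exact ha; exact hbh])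
    (by simp [Fin.sum_univ_three]; field_simp; ring)
    (by intro i _; fin_cases i <;> [exact one_div_nonneg.2 hr0.le; exact ht; exact ht])
  simp only [Fin.prod_univ_three, Matrix.cons_val_zero, Matrix.cons_val_one, Matrix.cons_val,
    lintegral_add_right_eq_self b h, mul_assoc, ← ENNReal.mul_rpow_of_nonneg _ _ ht] at hölder
  refine hölder.trans_eq' (lintegral_congr fun x => ?_)
  rw [mul_comm (a x), ← ENNReal.rpow_add_of_nonneg _ _ (by positivity) ht]
  congr 1
  field_simp
  ring

variable [SigmaFinite μ]

theorem aemeasurable_uncurry_add_mul (ha : AEMeasurable a μ) (hb : AEMeasurable b μ) :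
    AEMeasurable (fun q : G × G => b (q.2 + q.1) * a q.2) (μ.prod μ) :=
  (hb.comp_quasiMeasurePreserving (Measure.quasiMeasurePreserving_snd.comp
    (measurePreserving_prod_add_swap μ μ).quasiMeasurePreserving)).mul ha.comp_snd

theorem lintegral_lintegral_add_mul (ha : AEMeasurable a μ) (hb : AEMeasurable b μ) :
    ∫⁻ h, ∫⁻ x, b (x + h) * a x ∂μ ∂μ = (∫⁻ x, a x ∂μ) * ∫⁻ x, b x ∂μ := by
  rw [lintegral_lintegral_swap (aemeasurable_uncurry_add_mul ha hb)]
  have hx (x : G) : ∫⁻ h, b (x + h) * a x ∂μ = a x * ∫⁻ y, b y ∂μ := by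
    have hbx : AEMeasurable (fun h => b (x + h)) μ :=
      hb.comp_quasiMeasurePreserving (measurePreserving_add_left μ x).quasiMeasurePreserving
    rw [lintegral_mul_const'' _ hbx, lintegral_add_left_eq_self, mul_comm]
  simp only [hx, lintegral_mul_const'' _ ha]

/-- Young's convolution inequality `‖u ⋆ v‖_r ≤ ‖u‖_p ‖v‖_p` with `2 / p = 1 + 1 / r`, for
`u = a ^ p⁻¹` and `v = b ^ p⁻¹`. -/
theorem lintegral_lintegral_add_mul_rpow_le (ha : AEMeasurable a μ) (hb : AEMeasurable b μ)
    {r : ℝ} (hr : 1 ≤ r) :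
    ∫⁻ h, (∫⁻ x, (b (x + h) * a x) ^ ((r + 1) / (2 * r)) ∂μ) ^ r ∂μ ≤
      ((∫⁻ x, a x ∂μ) * ∫⁻ x, b x ∂μ) ^ ((r + 1) / 2) := by
  set AB := (∫⁻ x, a x ∂μ) * ∫⁻ x, b x ∂μ
  have hr0 : 0 < r := one_pos.trans_le hr
  calc ∫⁻ h, (∫⁻ x, (b (x + h) * a x) ^ ((r + 1) / (2 * r)) ∂μ) ^ r ∂μ
      ≤ ∫⁻ h, ((∫⁻ x, b (x + h) * a x ∂μ) ^ (1 / r) * AB ^ ((r - 1) / (2 * r))) ^ r ∂μ := by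
        gcongr with h
        exact lintegral_add_mul_rpow_le ha hb hr h
    _ = ∫⁻ h, (∫⁻ x, b (x + h) * a x ∂μ) * AB ^ ((r - 1) / 2) ∂μ := by
        refine lintegral_congr fun h => ?_
        rw [ENNReal.mul_rpow_of_nonneg _ _ hr0.le, ← ENNReal.rpow_mul, ← ENNReal.rpow_mul,
          one_div_mul_cancel hr0.ne', ENNReal.rpow_one]
        congr 2
        field_simp
    _ = AB ^ (1 : ℝ) * AB ^ ((r - 1) / 2) := by
        rw [lintegral_mul_const'' _ (aemeasurable_uncurry_add_mul ha hb).lintegral_prod_right',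
          lintegral_lintegral_add_mul ha hb, ENNReal.rpow_one]
    _ = AB ^ ((r + 1) / 2) := by
        rw [← ENNReal.rpow_add_of_nonneg _ _ zero_le_one (by linarith)]
        congr 1
        ring

end Young

section LpBound

variable {G : Type*} [AddCommGroup G] [MeasurableSpace G] [MeasurableAdd₂ G] {μ : Measure G}
  [SigmaFinite μ] [μ.IsAddLeftInvariant] {k : ℕ} {f w : G → ℝ}

theorem lintegral_eLpNorm_shiftMul_pow_le (hf : AEStronglyMeasurable f μ)
    (hw : AEStronglyMeasurable w μ) :
    ∫⁻ h, eLpNorm (shiftMul h f w) (.ofReal (pExp k)) μ ^ 2 ^ k ∂μ ≤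
      (eLpNorm f (.ofReal (pExp (k + 1))) μ * eLpNorm w (.ofReal (pExp (k + 1))) μ) ^ 2 ^ k := by
  have hyoung := lintegral_lintegral_add_mul_rpow_le (r := (k : ℝ) + 1)
    (hw.enorm.pow_const (pExp (k + 1))) (hf.enorm.pow_const (pExp (k + 1))) (by simp)
  have hleft (h : G) : (∫⁻ x, (‖f (x + h)‖ₑ ^ pExp (k + 1) * ‖w x‖ₑ ^ pExp (k + 1)) ^
      (((k : ℝ) + 1 + 1) / (2 * (k + 1))) ∂μ) ^ ((k : ℝ) + 1) =
        eLpNorm (shiftMul h f w) (.ofReal (pExp k)) μ ^ 2 ^ k := by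
    simp only [← ENNReal.mul_rpow_of_nonneg _ _ (pExp_pos _).le, ← ENNReal.rpow_mul, ← pExp_succ,
      ← enorm_mul]
    change (∫⁻ x, ‖shiftMul h f w x‖ₑ ^ pExp k ∂μ) ^ _ = _
    rw [lintegral_enorm_rpow (pExp_pos k), ← ENNReal.rpow_mul, pExp_mul]
    exact_mod_cast ENNReal.rpow_natCast _ _
  have hright : pExp (k + 1) * (((k : ℝ) + 1 + 1) / 2) = (2 ^ k : ℕ) := by
    have h := pExp_mul (k + 1)
    push_cast at h ⊢
    linear_combination h / 2
  simp only [hleft] at hyoung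
  rwa [lintegral_enorm_rpow (pExp_pos _), lintegral_enorm_rpow (pExp_pos _), mul_comm (_ ^ _),
    ← ENNReal.mul_rpow_of_nonneg _ _ (pExp_pos _).le, ← ENNReal.rpow_mul, hright,
    ENNReal.rpow_natCast] at hyoung

theorem aemeasurable_eLpNorm_shiftMul (hf : AEStronglyMeasurable f μ)
    (hw : AEStronglyMeasurable w μ) :
    AEMeasurable (fun h => eLpNorm (shiftMul h f w) (.ofReal (pExp k)) μ) μ := by
  simp only [eLpNorm_eq_lintegral_rpow_enorm_toReal (ENNReal.ofReal_ne_zero_iff.2 (pExp_pos k))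
    ENNReal.ofReal_ne_top]
  exact ((aestronglyMeasurable_uncurry_shiftMul hf hw).enorm.pow_const
    _).lintegral_prod_right'.pow_const _

theorem ae_memLp_shiftMul (hf : MemLp f (.ofReal (pExp (k + 1))) μ)
    (hw : MemLp w (.ofReal (pExp (k + 1))) μ) :
    ∀ᵐ h ∂μ, MemLp (shiftMul h f w) (.ofReal (pExp k)) μ := by
  have hfin := (lintegral_eLpNorm_shiftMul_pow_le hf.1 hw.1).trans_lt
    (ENNReal.pow_lt_top (ENNReal.mul_lt_top hf.2 hw.2))
  filter_upwards [ae_lt_top' ((aemeasurable_eLpNorm_shiftMul hf.1 hw.1).pow_const _) hfin.ne]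
    with h hh
  exact ⟨aestronglyMeasurable_shiftMul hf.1 hw.1 h, (ENNReal.pow_lt_top_iff.1 hh).resolve_right
    (by positivity)⟩

theorem lintegral_enorm_vertexProd_succ {F : (Fin (k + 1) → Fin 2) → G → ℝ}
    (hF : ∀ α, AEStronglyMeasurable (F α) μ) :
    ∫⁻ z, ‖vertexProd F z‖ₑ ∂cubeMeasure μ (k + 1) =
      ∫⁻ h, ∫⁻ z, ‖vertexProd (edgeMul h F) z‖ₑ ∂cubeMeasure μ k ∂μ := by
  have hcons := measurePreserving_cubeConsEquiv (μ := μ) (k := k)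
  rw [← hcons.lintegral_comp_emb (cubeConsEquiv G k).measurableEmbedding, lintegral_prod]
  · simp only [vertexProd_cubeConsEquiv]
  · exact ((aestronglyMeasurable_vertexProd hF).comp_measurePreserving hcons).enorm

/-- The factor `1 / 2 ^ k` comes from Hölder's inequality over the `2 ^ k` edges in one direction;
the products along these edges are estimated by Young's inequality. -/
theorem lintegral_enorm_vertexProd_le {F : (Fin k → Fin 2) → G → ℝ}
    (hF : ∀ α, AEStronglyMeasurable (F α) μ) :
    ∫⁻ z, ‖vertexProd F z‖ₑ ∂cubeMeasure μ k ≤ ∏ α, eLpNorm (F α) (.ofReal (pExp k)) μ := by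
  induction k with
  | zero =>
    rw [lintegral_enorm_vertexProd_zero (hF 0), Fintype.prod_subsingleton _ 0, pExp_zero,
      ENNReal.ofReal_one, eLpNorm_one_eq_lintegral_enorm]
  | succ k ih =>
    have hroot (t : ℝ≥0∞) : (t ^ 2 ^ k) ^ (1 / 2 ^ k : ℝ) = t := by
      simpa using ENNReal.pow_rpow_inv_natCast (n := 2 ^ k) (by positivity) t
    set u : (Fin k → Fin 2) → G → ℝ≥0∞ := fun β h => eLpNorm (edgeMul h F β) (.ofReal (pExp k)) μ
    calc ∫⁻ z, ‖vertexProd F z‖ₑ ∂cubeMeasure μ (k + 1)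
        = ∫⁻ h, ∫⁻ z, ‖vertexProd (edgeMul h F) z‖ₑ ∂cubeMeasure μ k ∂μ :=
          lintegral_enorm_vertexProd_succ hF
      _ ≤ ∫⁻ h, ∏ β, u β h ∂μ := by
          gcongr with h
          exact ih fun β => aestronglyMeasurable_shiftMul (hF _) (hF _) h
      _ = ∫⁻ h, ∏ β, (u β h ^ 2 ^ k) ^ (1 / 2 ^ k : ℝ) ∂μ := by simp only [hroot]
      _ ≤ ∏ β, (∫⁻ h, u β h ^ 2 ^ k ∂μ) ^ (1 / 2 ^ k : ℝ) :=
          ENNReal.lintegral_prod_norm_pow_le _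
            (fun β _ => (aemeasurable_eLpNorm_shiftMul (hF _) (hF _)).pow_const _)
            (by simp) (fun _ _ => by positivity)
      _ ≤ ∏ β, (eLpNorm (F (Fin.cons 1 β)) (.ofReal (pExp (k + 1))) μ *
            eLpNorm (F (Fin.cons 0 β)) (.ofReal (pExp (k + 1))) μ) := by
          gcongr with β
          exact (ENNReal.rpow_le_rpow (lintegral_eLpNorm_shiftMul_pow_le (hF _) (hF _))
            (by positivity)).trans_eq (hroot _)
      _ = ∏ α, eLpNorm (F α) (.ofReal (pExp (k + 1))) μ :=
          (prod_cube_succ fun α => eLpNorm (F α) (.ofReal (pExp (k + 1))) μ).symm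

theorem integrable_vertexProd {F : (Fin k → Fin 2) → G → ℝ}
    (hF : ∀ α, MemLp (F α) (.ofReal (pExp k)) μ) : Integrable (vertexProd F) (cubeMeasure μ k) :=
  ⟨aestronglyMeasurable_vertexProd fun α => (hF α).1,
    (lintegral_enorm_vertexProd_le fun α => (hF α).1).trans_lt
      (ENNReal.prod_lt_top fun α _ => (hF α).2)⟩

end LpBound

section CubeForm

variable {G : Type*} [AddCommGroup G] [MeasurableSpace G] {μ : Measure G} {k : ℕ}

variable (μ) in
/-- The Gowers inner product of a family of functions indexed by the vertices of the cube: the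
integral of `vertexProd F` over all cubes. -/
def cubeForm (F : (Fin k → Fin 2) → G → ℝ) : ℝ := ∫ z, vertexProd F z ∂cubeMeasure μ k

variable (μ k) in
/-- The Gowers inner product of `2 ^ k` copies of `f`, which for `k ≥ 1` is the `2 ^ k`-th power of
the Gowers-Host-Kra norm of `f`. -/
def energy (f : G → ℝ) : ℝ := cubeForm μ fun _ : Fin k → Fin 2 => f

variable (μ) in
/-- The integral of `vertexProd fun _ => f` over all cubes with given sides `H`. -/
def baseIntegral (f : G → ℝ) (H : Fin k → G) : ℝ := ∫ x, vertexProd (fun _ => f) (H, x) ∂μ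

variable [MeasurableAdd₂ G] [SigmaFinite μ] [μ.IsAddLeftInvariant] {f w : G → ℝ}

theorem cubeForm_congr_ae {F F' : (Fin k → Fin 2) → G → ℝ} (h : ∀ α, F α =ᵐ[μ] F' α) :
    cubeForm μ F = cubeForm μ F' :=
  integral_congr_ae (vertexProd_congr_ae h)

theorem enorm_cubeForm_le {F : (Fin k → Fin 2) → G → ℝ} (hF : ∀ α, AEStronglyMeasurable (F α) μ) :
    ‖cubeForm μ F‖ₑ ≤ ∏ α, eLpNorm (F α) (.ofReal (pExp k)) μ :=
  (enorm_integral_le_lintegral_enorm _).trans (lintegral_enorm_vertexProd_le hF)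

theorem integrable_vertexProd_edgeMul {F : (Fin (k + 1) → Fin 2) → G → ℝ}
    (hF : ∀ α, MemLp (F α) (.ofReal (pExp (k + 1))) μ) :
    Integrable (fun q : G × ((Fin k → G) × G) => vertexProd (edgeMul q.1 F) q.2)
      (μ.prod (cubeMeasure μ k)) := by
  simpa only [Function.comp_def, ← vertexProd_cubeConsEquiv, Prod.mk.eta] using
    measurePreserving_cubeConsEquiv.integrable_comp_of_integrable (integrable_vertexProd hF)

theorem integrable_cubeForm_edgeMul {F : (Fin (k + 1) → Fin 2) → G → ℝ}
    (hF : ∀ α, MemLp (F α) (.ofReal (pExp (k + 1))) μ) :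
    Integrable (fun h => cubeForm μ (edgeMul h F)) μ :=
  (integrable_vertexProd_edgeMul hF).integral_prod_left

theorem cubeForm_succ {F : (Fin (k + 1) → Fin 2) → G → ℝ}
    (hF : ∀ α, MemLp (F α) (.ofReal (pExp (k + 1))) μ) :
    cubeForm μ F = ∫ h, cubeForm μ (edgeMul h F) ∂μ := by
  have hedge := integrable_vertexProd_edgeMul hF
  simp only [← vertexProd_cubeConsEquiv] at hedge
  simp only [cubeForm, ← measurePreserving_cubeConsEquiv.integral_comp', integral_prod _ hedge,
    vertexProd_cubeConsEquiv]

/-- Applied to the family equal to `w` and to `f` on the two faces of the cube orthogonal to the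
first direction. -/
theorem integrable_vertexProd_shiftMul (hf : MemLp f (.ofReal (pExp (k + 1))) μ)
    (hw : MemLp w (.ofReal (pExp (k + 1))) μ) :
    Integrable (fun q : G × ((Fin k → G) × G) => vertexProd (fun _ => shiftMul q.1 f w) q.2)
      (μ.prod (cubeMeasure μ k)) :=
  integrable_vertexProd_edgeMul (F := fun α => ![w, f] (α 0)) fun α => by
    rcases Fin.exists_fin_two.1 ⟨α 0, rfl⟩ with h | h <;> simpa [h]

theorem integrable_energy_shiftMul (hf : MemLp f (.ofReal (pExp (k + 1))) μ)
    (hw : MemLp w (.ofReal (pExp (k + 1))) μ) :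
    Integrable (fun h => energy μ k (shiftMul h f w)) μ :=
  (integrable_vertexProd_shiftMul hf hw).integral_prod_left

theorem energy_succ (hf : MemLp f (.ofReal (pExp (k + 1))) μ) :
    energy μ (k + 1) f = ∫ h, energy μ k (shiftMul h f f) ∂μ :=
  cubeForm_succ fun _ => hf

theorem aestronglyMeasurable_vertexProd_mul (hf : AEStronglyMeasurable f μ)
    (hw : AEStronglyMeasurable w μ) :
    AEStronglyMeasurable (fun r : (Fin k → G) × (G × G) =>
      vertexProd (fun _ => w) (r.1, r.2.1) * vertexProd (fun _ => f) (r.1, r.2.2))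
      ((Measure.pi fun _ => μ).prod (μ.prod μ)) := by
  have hfst : Measure.QuasiMeasurePreserving (fun r : (Fin k → G) × (G × G) => (r.1, r.2.1))
      ((Measure.pi fun _ => μ).prod (μ.prod μ)) (cubeMeasure μ k) :=
    Measure.quasiMeasurePreserving_fst.comp
      ((measurePreserving_prodAssoc _ μ μ).symm MeasurableEquiv.prodAssoc).quasiMeasurePreserving
  have hsnd : Measure.QuasiMeasurePreserving (fun r : (Fin k → G) × (G × G) => (r.1, r.2.2))
      ((Measure.pi fun _ => μ).prod (μ.prod μ)) (cubeMeasure μ k) :=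
    hfst.comp ((MeasurePreserving.id _).prod Measure.measurePreserving_swap).quasiMeasurePreserving
  exact ((aestronglyMeasurable_vertexProd fun _ => hw).comp_quasiMeasurePreserving hfst).mul
    ((aestronglyMeasurable_vertexProd fun _ => hf).comp_quasiMeasurePreserving hsnd)

theorem integrable_vertexProd_mul (hf : MemLp f (.ofReal (pExp (k + 1))) μ)
    (hw : MemLp w (.ofReal (pExp (k + 1))) μ) :
    Integrable (fun r : (Fin k → G) × (G × G) =>
      vertexProd (fun _ => w) (r.1, r.2.1) * vertexProd (fun _ => f) (r.1, r.2.2))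
      ((Measure.pi fun _ => μ).prod (μ.prod μ)) := by
  rw [← (measurePreserving_cube_regroup (μ := μ) (k := k)).integrable_comp
    (aestronglyMeasurable_vertexProd_mul hf.1 hw.1)]
  simpa only [Function.comp_def, ← vertexProd_shiftMul] using integrable_vertexProd_shiftMul hf hw

theorem integrable_baseIntegral_mul (hf : MemLp f (.ofReal (pExp (k + 1))) μ)
    (hw : MemLp w (.ofReal (pExp (k + 1))) μ) :
    Integrable (fun H : Fin k → G => baseIntegral μ w H * baseIntegral μ f H)
      (Measure.pi fun _ => μ) := by
  simpa only [baseIntegral, ← integral_prod_mul] using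
    (integrable_vertexProd_mul hf hw).integral_prod_left

theorem integral_energy_shiftMul (hf : MemLp f (.ofReal (pExp (k + 1))) μ)
    (hw : MemLp w (.ofReal (pExp (k + 1))) μ) :
    ∫ h, energy μ k (shiftMul h f w) ∂μ =
      ∫ H : Fin k → G, baseIntegral μ w H * baseIntegral μ f H ∂Measure.pi fun _ => μ := by
  have hmul := integrable_vertexProd_mul hf hw
  have hregroup := measurePreserving_cube_regroup (μ := μ) (k := k)
  calc ∫ h, energy μ k (shiftMul h f w) ∂μ
      = ∫ q : G × ((Fin k → G) × G), vertexProd (fun _ => w) (q.2.1, q.2.2) *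
          vertexProd (fun _ => f) (q.2.1, q.2.2 + q.1) ∂μ.prod (cubeMeasure μ k) := by
        simp only [← vertexProd_shiftMul]
        exact (integral_prod _ (integrable_vertexProd_shiftMul hf hw)).symm
    _ = ∫ r : (Fin k → G) × (G × G), vertexProd (fun _ => w) (r.1, r.2.1) *
          vertexProd (fun _ => f) (r.1, r.2.2) ∂(Measure.pi fun _ => μ).prod (μ.prod μ) := by
        rw [← hregroup.map_eq, integral_map hregroup.aemeasurable
          (hregroup.map_eq.symm ▸ hmul.aestronglyMeasurable)]
    _ = ∫ H : Fin k → G, baseIntegral μ w H * baseIntegral μ f H ∂Measure.pi fun _ => μ := by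
        simp only [integral_prod _ hmul, baseIntegral, ← integral_prod_mul]

theorem energy_succ_eq_integral_sq (hf : MemLp f (.ofReal (pExp (k + 1))) μ) :
    energy μ (k + 1) f = ∫ H : Fin k → G, baseIntegral μ f H ^ 2 ∂Measure.pi fun _ => μ := by
  simp only [energy_succ hf, integral_energy_shiftMul hf hf, sq]

theorem energy_nonneg {k : ℕ} (hk : k ≠ 0) (hf : MemLp f (.ofReal (pExp k)) μ) :
    0 ≤ energy μ k f := by
  obtain ⟨j, rfl⟩ := Nat.exists_eq_succ_of_ne_zero hk
  rw [energy_succ_eq_integral_sq hf]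
  exact integral_nonneg fun H => sq_nonneg _

theorem two_mul_integral_energy_shiftMul_le (hf : MemLp f (.ofReal (pExp (k + 1))) μ)
    (hw : MemLp w (.ofReal (pExp (k + 1))) μ) :
    2 * ∫ h, energy μ k (shiftMul h f w) ∂μ ≤ energy μ (k + 1) f + energy μ (k + 1) w := by
  have hff := integrable_baseIntegral_mul hf hf
  have hww := integrable_baseIntegral_mul hw hw
  rw [integral_energy_shiftMul hf hw, energy_succ_eq_integral_sq hf, energy_succ_eq_integral_sq hw,
    ← integral_const_mul]
  simp only [← sq] at hff hww
  rw [← integral_add hff hww]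
  refine integral_mono ((integrable_baseIntegral_mul hf hw).const_mul 2) (hff.add hww) fun H => ?_
  simpa only [mul_assoc, add_comm, Pi.add_apply] using
    two_mul_le_add_sq (baseIntegral μ w H) (baseIntegral μ f H)

/-- The Gowers-Cauchy-Schwarz inequality, in the form obtained from the usual one by the inequality
of arithmetic and geometric means. -/
theorem two_pow_mul_cubeForm_le {F : (Fin k → Fin 2) → G → ℝ}
    (hF : ∀ α, MemLp (F α) (.ofReal (pExp k)) μ) :
    2 ^ k * cubeForm μ F ≤ ∑ α, energy μ k (F α) := by
  induction k with
  | zero =>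
    have hconst : (fun _ => F 0) = F := funext fun α => congrArg F (Subsingleton.elim 0 α)
    rw [Fintype.sum_subsingleton _ 0, energy, hconst, pow_zero, one_mul]
  | succ k ih =>
    have hint (β : Fin k → Fin 2) : Integrable (fun h => energy μ k (edgeMul h F β)) μ :=
      integrable_energy_shiftMul (hF _) (hF _)
    have hface : 2 ^ k * cubeForm μ F ≤ ∑ β, ∫ h, energy μ k (edgeMul h F β) ∂μ := by
      rw [cubeForm_succ hF, ← integral_const_mul, ← integral_finsetSum _ fun β _ => hint β]
      refine integral_mono_ae ((integrable_cubeForm_edgeMul hF).const_mul _)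
        (integrable_finsetSum _ fun β _ => hint β) ?_
      filter_upwards [ae_all_iff.2 fun β => ae_memLp_shiftMul (hF (Fin.cons 1 β))
        (hF (Fin.cons 0 β))] with h hh
      exact ih hh
    calc 2 ^ (k + 1) * cubeForm μ F
        = 2 * (2 ^ k * cubeForm μ F) := by ring
      _ ≤ ∑ β, 2 * ∫ h, energy μ k (edgeMul h F β) ∂μ := by
        rw [← Finset.mul_sum]
        gcongr
      _ ≤ ∑ β : Fin k → Fin 2,
          (energy μ (k + 1) (F (Fin.cons 1 β)) + energy μ (k + 1) (F (Fin.cons 0 β))) :=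
        Finset.sum_le_sum fun β _ => two_mul_integral_energy_shiftMul_le (hF _) (hF _)
      _ = ∑ α, energy μ (k + 1) (F α) := (sum_cube_succ fun α => energy μ (k + 1) (F α)).symm

end CubeForm

section DualFunction

variable {G : Type*} [AddCommGroup G] [MeasurableSpace G] {μ : Measure G} {k : ℕ}

variable (μ k) in
/-- The Gowers-Host-Kra dual function `D_k f`. -/
def ghkDual (f : G → ℝ) (x : G) : ℝ :=
  ∫ h : Fin k → G, puncturedProd f (h, x) ∂Measure.pi fun _ => μ

variable [MeasurableAdd₂ G] [SigmaFinite μ] [μ.IsAddLeftInvariant]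

theorem integrable_vertexProd_update {F : (Fin k → Fin 2) → G → ℝ}
    (hF : ∀ α, MemLp (F α) (.ofReal (pExp k)) μ) {w : G → ℝ} (hw : MemLp w (.ofReal (pExp k)) μ)
    (α : Fin k → Fin 2) : Integrable (vertexProd (Function.update F α w)) (cubeMeasure μ k) :=
  integrable_vertexProd <| (Function.forall_update_iff F fun _ u => MemLp u _ μ).2
    ⟨hw, fun β _ => hF β⟩

variable {f w : G → ℝ}

theorem integrable_mul_puncturedProd (hf : MemLp f (.ofReal (pExp k)) μ)
    (hw : MemLp w (.ofReal (pExp k)) μ) :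
    Integrable (fun z : (Fin k → G) × G => w z.2 * puncturedProd f z) (cubeMeasure μ k) :=
  (integrable_vertexProd_update (fun _ => hf) hw 0).congr
    (.of_forall (vertexProd_update_zero f w))

theorem integrable_mul_ghkDual (hf : MemLp f (.ofReal (pExp k)) μ)
    (hw : MemLp w (.ofReal (pExp k)) μ) : Integrable (fun x => w x * ghkDual μ k f x) μ := by
  simpa only [integral_const_mul, ghkDual] using
    (integrable_mul_puncturedProd hf hw).integral_prod_right

theorem cubeForm_update_eq_integral_mul_ghkDual (hf : MemLp f (.ofReal (pExp k)) μ)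
    (hw : MemLp w (.ofReal (pExp k)) μ) :
    cubeForm μ (Function.update (fun _ : Fin k → Fin 2 => f) 0 w) =
      ∫ x, w x * ghkDual μ k f x ∂μ := by
  simp only [cubeForm, vertexProd_update_zero,
    integral_prod_symm _ (integrable_mul_puncturedProd hf hw), integral_const_mul, ghkDual]

theorem ae_integrable_puncturedProd (hf : MemLp f (.ofReal (pExp k)) μ) :
    ∀ᵐ x ∂μ, Integrable (fun h : Fin k → G => puncturedProd f (h, x)) (Measure.pi fun _ => μ) := by
  have hset (n : ℕ) := (integrable_mul_puncturedProd hf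
    (memLp_indicator_const (.ofReal (pExp k)) (measurableSet_spanningSets μ n) (1 : ℝ)
      (.inr (measure_spanningSets_lt_top μ n).ne))).prod_left_ae
  filter_upwards [ae_all_iff.2 hset] with x hx
  obtain ⟨n, hn⟩ := Set.mem_iUnion.1 ((iUnion_spanningSets μ).symm ▸ Set.mem_univ x)
  simpa [Set.indicator_of_mem hn] using hx n

theorem ae_eq_ghkDual (hf : MemLp f (.ofReal (pExp k)) μ) {q : ℝ≥0∞} (hq : 1 ≤ q) {u : G → ℝ}
    (hu : MemLp u q μ) (h : ∀ w, MemLp w (.ofReal (pExp k)) μ →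
      ∫ x, w x * u x ∂μ = ∫ x, w x * ghkDual μ k f x ∂μ) : u =ᵐ[μ] ghkDual μ k f := by
  have hset {A : Set G} (hA : MeasurableSet A) (hfin : μ A < ∞) :
      MemLp (A.indicator fun _ => (1 : ℝ)) (.ofReal (pExp k)) μ :=
    memLp_indicator_const _ hA 1 (.inr hfin.ne)
  have hmul (A : Set G) (v : G → ℝ) :
      (fun x => A.indicator (fun _ => (1 : ℝ)) x * v x) = A.indicator v := by
    ext x
    by_cases hx : x ∈ A <;> simp [hx]
  refine ae_eq_of_forall_setIntegral_eq_of_sigmaFinite (fun A _ hfin => ?_)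
    (fun A hA hfin => ?_) fun A hA hfin => ?_
  · have : IsFiniteMeasure (μ.restrict A) := isFiniteMeasure_restrict.2 hfin.ne
    exact (hu.restrict A).integrable hq
  · rw [← integrable_indicator_iff hA, ← hmul]
    exact integrable_mul_ghkDual hf (hset hA hfin)
  · simpa only [hmul, integral_indicator hA] using h _ (hset hA hfin)

end DualFunction

section Norm

variable {G : Type*} [AddCommGroup G] [MeasurableSpace G] (μ : Measure G)

/-- The Gowers-Host-Kra norms on a measured group. The value at index `0` is a placeholder. -/
def ghkNorm : ℕ → (G → ℝ) → ℝ≥0∞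
  | 0, _ => 0
  | 1, f => ‖∫ x, f x ∂μ‖ₑ
  | k + 2, f =>
      (∫⁻ h, ghkNorm (k + 1) (shiftMul h f f) ^ (2 ^ (k + 1) : ℕ) ∂μ) ^ (1 / 2 ^ (k + 2) : ℝ)

/-- The norm dual to `ghkNorm μ k` on `L^{p_k}`. -/
def ghkDualNorm (k : ℕ) (g : G → ℝ) : ℝ≥0∞ :=
  ⨆ (f : G → ℝ) (_ : MemLp f (.ofReal (pExp k)) μ ∧ ghkNorm μ k f ≤ 1), ‖∫ x, g x * f x ∂μ‖ₑ

variable {μ} {k : ℕ} {f : G → ℝ}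

theorem ghkDualNorm_congr_ae {u w : G → ℝ} (h : u =ᵐ[μ] w) :
    ghkDualNorm μ k u = ghkDualNorm μ k w :=
  iSup_congr fun _ => iSup_congr fun _ => congrArg enorm <| integral_congr_ae (h.mul .rfl)

theorem energy_const_mul (c : ℝ) (f : G → ℝ) :
    energy μ k (fun x => c * f x) = c ^ 2 ^ k * energy μ k f := by
  simp [energy, cubeForm, vertexProd, Finset.prod_mul_distrib, integral_const_mul]

variable [MeasurableAdd₂ G] [SigmaFinite μ] [μ.IsAddLeftInvariant]

theorem energy_one (hf : MemLp f (.ofReal (pExp 1)) μ) : energy μ 1 f = (∫ x, f x ∂μ) ^ 2 := by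
  have : IsProbabilityMeasure (Measure.pi fun _ : Fin 0 => μ) := ⟨Measure.pi_empty_univ _⟩
  rw [energy_succ_eq_integral_sq hf]
  simp [baseIntegral, vertexProd_zero]

theorem ghkNorm_succ_pow (hf : MemLp f (.ofReal (pExp (k + 1))) μ) :
    ghkNorm μ (k + 1) f ^ 2 ^ (k + 1) = ENNReal.ofReal (energy μ (k + 1) f) := by
  induction k generalizing f with
  | zero =>
    rw [energy_one hf, ← sq_abs, ENNReal.ofReal_pow (abs_nonneg _), ← Real.enorm_eq_ofReal_abs]
    rfl
  | succ k ih =>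
    have hshift := ae_memLp_shiftMul hf hf
    rw [energy_succ hf, ofReal_integral_eq_lintegral_ofReal (integrable_energy_shiftMul hf hf)
      (hshift.mono fun h hh => energy_nonneg k.succ_ne_zero hh), ghkNorm, one_div]
    have hroot := ENNReal.rpow_inv_natCast_pow (n := 2 ^ (k + 2)) (by positivity)
      (∫⁻ h, ghkNorm μ (k + 1) (shiftMul h f f) ^ 2 ^ (k + 1) ∂μ)
    push_cast at hroot
    exact hroot.trans (lintegral_congr_ae (hshift.mono fun h hh => ih hh))

theorem ghkNorm_le_one_iff (hk : k ≠ 0) (hf : MemLp f (.ofReal (pExp k)) μ) :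
    ghkNorm μ k f ≤ 1 ↔ energy μ k f ≤ 1 := by
  obtain ⟨j, rfl⟩ := Nat.exists_eq_succ_of_ne_zero hk
  rw [← pow_le_one_iff (pow_ne_zero (j + 1) two_ne_zero), ghkNorm_succ_pow hf,
    ENNReal.ofReal_le_one]

theorem integral_mul_le_of_energy_le (hk : k ≠ 0) (hf : MemLp f (.ofReal (pExp k)) μ) {g : G → ℝ}
    (hg : ghkDualNorm μ k g ≤ 1) {v : ℝ} (hv : 0 < v) (hfv : energy μ k f ≤ v ^ 2 ^ k) :
    ∫ x, g x * f x ∂μ ≤ v := by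
  have hscaled : MemLp (fun x => v⁻¹ * f x) (.ofReal (pExp k)) μ := hf.const_mul v⁻¹
  have hnorm : ghkNorm μ k (fun x => v⁻¹ * f x) ≤ 1 := by
    rw [ghkNorm_le_one_iff hk hscaled, energy_const_mul, inv_pow, inv_mul_le_one₀ (by positivity)]
    exact hfv
  have hle : ‖∫ x, g x * (v⁻¹ * f x) ∂μ‖ₑ ≤ 1 :=
    iSup₂_le_iff.1 hg _ ⟨hscaled, hnorm⟩
  simp only [mul_left_comm (g _), integral_const_mul] at hle
  rw [Real.enorm_eq_ofReal_abs, ENNReal.ofReal_le_one, inv_mul_eq_div] at hle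
  exact (div_le_one hv).1 ((le_abs_self _).trans hle)

end Norm

section EulerLagrange

open Filter Topology

variable {G : Type*} [AddCommGroup G] [MeasurableSpace G] {μ : Measure G} {k : ℕ}

theorem cubeForm_update_smul (F : (Fin k → Fin 2) → G → ℝ) (α : Fin k → Fin 2) (c : ℝ)
    (w : G → ℝ) : cubeForm μ (Function.update F α (c • w)) =
      c * cubeForm μ (Function.update F α w) := by
  simp only [cubeForm, vertexProd_update, Pi.smul_apply, smul_eq_mul, mul_assoc,
    integral_const_mul]

variable [MeasurableAdd₂ G] [SigmaFinite μ] [μ.IsAddLeftInvariant]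

theorem cubeForm_update_add {F : (Fin k → Fin 2) → G → ℝ}
    (hF : ∀ α, MemLp (F α) (.ofReal (pExp k)) μ) (α : Fin k → Fin 2) {u w : G → ℝ}
    (hu : MemLp u (.ofReal (pExp k)) μ) (hw : MemLp w (.ofReal (pExp k)) μ) :
    cubeForm μ (Function.update F α (u + w)) =
      cubeForm μ (Function.update F α u) + cubeForm μ (Function.update F α w) := by
  rw [cubeForm, cubeForm, cubeForm, ← integral_add (integrable_vertexProd_update hF hu α)
    (integrable_vertexProd_update hF hw α)]
  simp only [vertexProd_update, Pi.add_apply, add_mul]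

theorem cubeForm_update_congr_ae (F : (Fin k → Fin 2) → G → ℝ) (α : Fin k → Fin 2)
    {u w : G → ℝ} (h : u =ᵐ[μ] w) :
    cubeForm μ (Function.update F α u) = cubeForm μ (Function.update F α w) := by
  refine cubeForm_congr_ae fun β => ?_
  rcases eq_or_ne β α with rfl | hβ
  · simpa only [Function.update_self] using h
  · simp only [Function.update_of_ne hβ, EventuallyEq.rfl]

theorem energy_div_add_cubeForm_sub_le {f w : G → ℝ} (hf : MemLp f (.ofReal (pExp k)) μ)
    (hw : MemLp w (.ofReal (pExp k)) μ) :
    energy μ k f / 2 ^ k +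
      (cubeForm μ (Function.update (fun _ : Fin k → Fin 2 => f) 0 w) - energy μ k f) ≤
        energy μ k w / 2 ^ k := by
  have hgcs := two_pow_mul_cubeForm_le (F := Function.update (fun _ : Fin k → Fin 2 => f) 0 w)
    ((Function.forall_update_iff _ fun _ u => MemLp u _ μ).2 ⟨hw, fun _ _ => hf⟩)
  have hsum : ∑ α, energy μ k (Function.update (fun _ : Fin k → Fin 2 => f) 0 w α) =
      energy μ k w + (2 ^ k - 1) * energy μ k f := by
    simp only [Function.apply_update (fun _ => energy μ k)]
    rw [Finset.sum_update_of_mem (Finset.mem_univ _)]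
    simp [Finset.card_sdiff]
  rw [hsum] at hgcs
  field_simp
  linarith

variable [Fact (1 < pExp k)]

variable (μ k) in
/-- The Gowers inner product as a continuous multilinear form on `L^{p_k}`. -/
def cubeMultilinear :
    ContinuousMultilinearMap ℝ (fun _ : Fin k → Fin 2 => Lp ℝ (.ofReal (pExp k)) μ) ℝ :=
  MultilinearMap.mkContinuous
    (MultilinearMap.mk' (fun F => cubeForm μ fun α => F α)
      (fun F α u w => by
        simp only [Function.apply_update (fun _ (v : Lp ℝ (.ofReal (pExp k)) μ) => (v : G → ℝ))]
        rw [cubeForm_update_congr_ae _ _ (Lp.coeFn_add u w), cubeForm_update_add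
          (fun β => Lp.memLp (F β)) α (Lp.memLp u) (Lp.memLp w)])
      (fun F α c w => by
        simp only [Function.apply_update (fun _ (v : Lp ℝ (.ofReal (pExp k)) μ) => (v : G → ℝ))]
        rw [cubeForm_update_congr_ae _ _ (Lp.coeFn_smul c w), cubeForm_update_smul, smul_eq_mul]))
    1 fun F => by
      rw [one_mul]
      have hle := enorm_cubeForm_le fun α => Lp.aestronglyMeasurable (F α)
      simp only [← Lp.enorm_def, ← ofReal_norm] at hle
      rwa [← ENNReal.ofReal_prod_of_nonneg fun _ _ => norm_nonneg _,
        ENNReal.ofReal_le_ofReal_iff (by positivity)] at hle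

theorem continuous_energy : Continuous fun f : Lp ℝ (.ofReal (pExp k)) μ => energy μ k f :=
  (cubeMultilinear μ k).cont.comp (continuous_pi fun _ => continuous_id)

/-- The derivative of `energy μ k / 2 ^ k` on `L^{p_k}`, in the form of the Gowers inner product of
its argument at the base point with copies of `f` at all other vertices. -/
def energyDeriv (f : Lp ℝ (.ofReal (pExp k)) μ) : Lp ℝ (.ofReal (pExp k)) μ →L[ℝ] ℝ :=
  (cubeMultilinear μ k).toContinuousLinearMap (fun _ => f) 0

theorem energyDeriv_apply (f w : Lp ℝ (.ofReal (pExp k)) μ) :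
    energyDeriv f w = cubeForm μ (Function.update (fun _ : Fin k → Fin 2 => (f : G → ℝ)) 0 w) :=
  congrArg (cubeForm μ) <| funext <|
    Function.apply_update (fun _ (v : Lp ℝ (.ofReal (pExp k)) μ) => (v : G → ℝ)) _ 0 w

theorem energyDeriv_self (f : Lp ℝ (.ofReal (pExp k)) μ) : energyDeriv f f = energy μ k f := by
  rw [energyDeriv_apply, Function.update_eq_self, energy]

theorem energyDeriv_eq_integral (f w : Lp ℝ (.ofReal (pExp k)) μ) :
    energyDeriv f w = ∫ x, w x * ghkDual μ k f x ∂μ := by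
  rw [energyDeriv_apply, cubeForm_update_eq_integral_mul_ghkDual (Lp.memLp f) (Lp.memLp w)]

theorem energy_div_add_energyDeriv_le (f w : Lp ℝ (.ofReal (pExp k)) μ) :
    energy μ k f / 2 ^ k + energyDeriv f (w - f) ≤ energy μ k w / 2 ^ k := by
  rw [map_sub, energyDeriv_self, energyDeriv_apply]
  exact energy_div_add_cubeForm_sub_le (Lp.memLp f) (Lp.memLp w)

theorem continuous_energyDeriv_add_smul (f w : Lp ℝ (.ofReal (pExp k)) μ) :
    Continuous fun t : ℝ => energyDeriv (f + t • w) w :=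
  have hline : Continuous fun t : ℝ => fun _ : Fin k → Fin 2 => f + t • w := by fun_prop
  (cubeMultilinear μ k).cont.comp (hline.update 0 continuous_const)

/-- The Euler-Lagrange equation of the functional
`energy μ k f / 2 ^ k - ⟨g, f⟩ + c * ‖f‖ ^ p_k / p_k`. -/
theorem exists_energyDeriv_add_dualityMap_eq (g : Lp ℝ (.ofReal (pExp k).conjExponent) μ) {c : ℝ}
    (hc : 0 < c) : ∃ f : Lp ℝ (.ofReal (pExp k)) μ,
      energyDeriv f + c • dualPairing (dualityMap f) = dualPairing g := by
  obtain ⟨f, hf⟩ := exists_add_dualityMap_eq_zero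
    (Ψ := fun f => energy μ k f / 2 ^ k - dualPairing g f)
    (A := fun f => energyDeriv f - dualPairing g)
    ((continuous_energy.div_const _).sub (dualPairing g).continuous)
    (fun f w => by
      have hsub := energy_div_add_energyDeriv_le f w
      rw [sub_apply, map_sub (dualPairing g)]
      linarith)
    (fun f w => by
      have hline := (continuous_energyDeriv_add_smul f w).tendsto 0
      rw [zero_smul, add_zero] at hline
      exact (hline.mono_left nhdsWithin_le_nhds).sub_const _) hc
  exact ⟨f, by rwa [sub_add_eq_add_sub, sub_eq_zero] at hf⟩

end EulerLagrange

theorem add_le_one_of_forall_le_pow {N : ℕ} (hN : 1 < N) {a b : ℝ} (hb : 0 ≤ b)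
    (h : ∀ v > 0, a ≤ v ^ N → a + b ≤ v) : a + b ≤ 1 := by
  suffices ha : a ≤ 1 from h 1 one_pos (by rwa [one_pow])
  by_contra! ha
  have hpow : (a ^ (N⁻¹ : ℝ)) ^ N = a := Real.rpow_inv_natCast_pow (by positivity) (by positivity)
  have hroot : 1 < a ^ (N⁻¹ : ℝ) := Real.one_lt_rpow ha (by positivity)
  linarith [h _ (one_pos.trans hroot) hpow.ge, lt_self_pow₀ hroot hN]

section Decomposition

variable {G : Type*} [AddCommGroup G] [MeasurableSpace G] [MeasurableAdd₂ G] {μ : Measure G}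
  [SigmaFinite μ] [μ.IsAddLeftInvariant] {k : ℕ} [Fact (1 < pExp k)]
  {f : Lp ℝ (.ofReal (pExp k)) μ} {g : Lp ℝ (.ofReal (pExp k).conjExponent) μ} {c : ℝ}

theorem ae_eq_ghkDual_add (h : energyDeriv f + c • dualPairing (dualityMap f) = dualPairing g) :
    ∀ᵐ x ∂μ, g x = ghkDual μ k f x + (c • dualityMap f) x := by
  have hdual : (g - c • dualityMap f : Lp ℝ _ μ) =ᵐ[μ] ghkDual μ k f := by
    refine ae_eq_ghkDual (Lp.memLp f) (Fact.out : 1 ≤ ENNReal.ofReal (pExp k).conjExponent)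
      (Lp.memLp _) fun w hw => ?_
    have hpair : dualPairing (g - c • dualityMap f) (hw.toLp w) = energyDeriv f (hw.toLp w) := by
      rw [map_sub, map_smul, ← h, add_sub_cancel_right]
    rw [dualPairing_eq_integral, energyDeriv_eq_integral] at hpair
    have hcongr (u : G → ℝ) : ∫ x, hw.toLp w x * u x ∂μ = ∫ x, w x * u x ∂μ :=
      integral_congr_ae <| hw.coeFn_toLp.mul .rfl
    simpa only [mul_comm _ (hw.toLp w _), hcongr] using hpair
  filter_upwards [hdual, Lp.coeFn_sub g (c • dualityMap f)] with x hx hsub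
  rw [← hx, hsub, Pi.sub_apply, sub_add_cancel]

theorem energy_add_mul_norm_rpow_le_one
    (h : energyDeriv f + c • dualPairing (dualityMap f) = dualPairing g) (hk : k ≠ 0) (hc : 0 ≤ c)
    (hg : ghkDualNorm μ k g ≤ 1) : energy μ k f + c * ‖f‖ ^ pExp k ≤ 1 := by
  refine add_le_one_of_forall_le_pow (Nat.one_lt_two_pow hk) (by positivity)
    fun v hv hfv => ?_
  have hself := DFunLike.congr_fun h f
  rw [add_apply, smul_apply, energyDeriv_self, dualPairing_dualityMap_self,
    dualPairing_eq_integral, smul_eq_mul] at hself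
  exact hself.trans_le (integral_mul_le_of_energy_le hk (Lp.memLp f) hg hv hfv)

theorem exists_ae_eq_ghkDual_add (hk : k ≠ 0) {δ : ℝ} (hδ : 0 < δ)
    (hg : ghkDualNorm μ k g ≤ 1) :
    ∃ (F : Lp ℝ (.ofReal (pExp k)) μ) (H : Lp ℝ (.ofReal (pExp k).conjExponent) μ),
      (∀ᵐ x ∂μ, g x = ghkDual μ k F x + H x) ∧ ghkNorm μ k F ≤ 1 ∧ ‖F‖ ≤ 1 / δ ∧ ‖H‖ ≤ δ := by
  obtain ⟨F, hF⟩ := exists_energyDeriv_add_dualityMap_eq g (Real.rpow_pos_of_pos hδ (pExp k))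
  have hle := energy_add_mul_norm_rpow_le_one hF hk (by positivity) hg
  have hrpow : 0 ≤ δ ^ pExp k * ‖F‖ ^ pExp k := by positivity
  have hnonneg : 0 ≤ energy μ k F := energy_nonneg hk (Lp.memLp F)
  have henergy : energy μ k F ≤ 1 := by linarith
  have hscaled : δ * ‖F‖ ≤ 1 := by
    rw [← Real.rpow_le_rpow_iff (by positivity) zero_le_one (pExp_pos k), Real.one_rpow,
      Real.mul_rpow hδ.le (norm_nonneg F)]
    linarith
  exact ⟨F, δ ^ pExp k • dualityMap F, ae_eq_ghkDual_add hF,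
    (ghkNorm_le_one_iff hk (Lp.memLp F)).2 henergy, (le_div_iff₀' hδ).2 hscaled,
    norm_rpow_smul_dualityMap_le hδ hscaled⟩

end Decomposition

theorem gowersNorm_eq_ghkNorm {d : ℕ} (k : ℕ) (f : EuclideanSpace ℝ (Fin d) → ℝ) :
    gowersNorm k f = ghkNorm volume k f := by
  induction k using Nat.twoStepInduction generalizing f with
  | zero => rfl
  | one => rfl
  | more k _ ih => simp only [gowersNorm, ghkNorm, ih]; rfl

theorem antiUniformNorm_eq_ghkDualNorm {d : ℕ} (k : ℕ) (g : EuclideanSpace ℝ (Fin d) → ℝ) :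
    antiUniformNorm k g = ghkDualNorm volume k g := by
  simp only [antiUniformNorm, ghkDualNorm, gowersNorm_eq_ghkNorm]

end GowersHostKra

end

open GowersHostKra

theorem theorem4_general {G : Type*} [AddCommGroup G] [MeasurableSpace G] [MeasurableAdd₂ G]
    {μ : Measure G} [SigmaFinite μ] [μ.IsAddLeftInvariant] {k : ℕ} (hk : 2 ≤ k) {δ : ℝ}
    (hδ : 0 < δ) {g : G → ℝ} (hg : MemLp g (.ofReal (sExp k)) μ) (hg1 : ghkDualNorm μ k g ≤ 1) :
    ∃ F H : G → ℝ, MemLp F (.ofReal (pExp k)) μ ∧ MemLp H (.ofReal (sExp k)) μ ∧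
      (∀ᵐ x ∂μ, Integrable (fun h : Fin k → G => puncturedProd F (h, x))
        (Measure.pi fun _ => μ)) ∧
      (∀ᵐ x ∂μ, g x = ghkDual μ k F x + H x) ∧ ghkNorm μ k F ≤ 1 ∧
      eLpNorm F (.ofReal (pExp k)) μ ≤ .ofReal (1 / δ) ∧
      eLpNorm H (.ofReal (sExp k)) μ ≤ .ofReal δ := by
  have : Fact (1 < pExp k) := ⟨one_lt_pExp hk⟩
  rw [← (holderConjugate_pExp_sExp hk).conjExponent_eq] at *
  rw [← ghkDualNorm_congr_ae hg.coeFn_toLp] at hg1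
  obtain ⟨F, H, hgFH, hFU, hF, hH⟩ := exists_ae_eq_ghkDual_add (by positivity) hδ hg1
  refine ⟨F, H, Lp.memLp F, Lp.memLp H, ae_integrable_puncturedProd (Lp.memLp F),
    hg.coeFn_toLp.symm.trans hgFH, hFU, ?_, ?_⟩
  · simpa only [← Lp.enorm_def, ← ofReal_norm] using ENNReal.ofReal_le_ofReal hF
  · simpa only [← Lp.enorm_def, ← ofReal_norm] using ENNReal.ofReal_le_ofReal hH

theorem theorem4 (d k : ℕ) (hk : 2 ≤ k) (δ : ℝ) (hδ : 0 < δ)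
    (g : EuclideanSpace ℝ (Fin d) → ℝ)
    (hg : MemLp g (ENNReal.ofReal (sExp k)) volume)
    (hg1 : antiUniformNorm k g = 1) :
    ∃ F H : EuclideanSpace ℝ (Fin d) → ℝ,
      MemLp F (ENNReal.ofReal (pExp k)) volume ∧
      MemLp H (ENNReal.ofReal (sExp k)) volume ∧
      (∀ᵐ x : EuclideanSpace ℝ (Fin d), Integrable (cubeProd k F x) volume) ∧
      (∀ᵐ x : EuclideanSpace ℝ (Fin d), g x = dualFun k F x + H x) ∧
      gowersNorm k F ≤ 1 ∧
      eLpNorm F (ENNReal.ofReal (pExp k)) volume ≤ ENNReal.ofReal (1 / δ) ∧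
      eLpNorm H (ENNReal.ofReal (sExp k)) volume ≤ ENNReal.ofReal δ := by
  simp only [gowersNorm_eq_ghkNorm]
  exact theorem4_general hk hδ hg ((antiUniformNorm_eq_ghkDualNorm k g).symm.trans hg1).le
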